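/- Let $G$ be a unipotent algebraic $\mathbb{Z}$-group, i.e. an affine group scheme of finite type over $\mathbb{Z}$ whose generic fibre $G_{\mathbb{Q}}$ is a unipotent algebraic group (isomorphic over $\mathbb{Q}$ to a closed subgroup of the group of upper unitriangular $n\times n$ matrices for some $n$). For subgroups $\Delta_1,\Delta_2$ of a common group, let $c(\Delta_1,\Delta_2)=[\Delta_1:\Delta_1\cap\Delta_2]\,[\Delta_2:\Delta_1\cap\Delta_2]$ be their commensurability index; they are commensurable if it is finite. An arithmetic lattice of $G$ is a subgroup of $G(\mathbb{R})$ commensurable with $G(\mathbb{Z})$. Let $p$ be a prime and let $k\ge 0$ be an integer, and give $G(\mathbb{Q}_p)$ its $p$-adic topology. Then every arithmetic lattice $\Delta$ of $G$ with $c(\Delta,G(\mathbb{Z}))=p^k$ is contained in $G(\mathbb{Q})$, and so may be regarded as a subgroup of $G(\mathbb{Q}_p)$; and the map $\Delta\mapsto\overline{\Delta}$, where $\overline{\Delta}$ is the closure of $\Delta$ in $G(\mathbb{Q}_p)$, is a bijection from the set of arithmetic lattices $\Delta$ of $G$ with $c(\Delta,G(\mathbb{Z}))=p^k$ onto the set of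 closed subgroups $H$ of $G(\mathbb{Q}_p)$ with $c(H,G(\mathbb{Z}_p))=p^k$. -/

import Mathlib

open scoped TensorProduct

noncomputable section

/-- The group `G(R) = Hom_{k-alg}(A, R)` of `R`-valued points of the affine group scheme
`G = Spec A` over `k`, where `A` is a commutative Hopf algebra over `k`. Multiplication is
convolution, i.e. it is induced by the comultiplication of `A`. -/
def Points (k A R : Type*) [CommRing k] [CommRing A] [HopfAlgebra k A] [CommRing R]
    [Algebra k R] : Type _ :=
  WithConv (A →ₐ[k] R)

namespace Points

section Group

variable {k A R S : Type*} [CommRing k] [CommRing A] [HopfAlgebra k A]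
  [CommRing R] [Algebra k R] [CommRing S] [Algebra k S]

/-- The point given by an algebra homomorphism. -/
def mk (f : A →ₐ[k] R) : Points k A R := WithConv.toConv f

/-- The algebra homomorphism underlying a point. -/
def hom (x : Points k A R) : A →ₐ[k] R := WithConv.ofConv x

@[ext] theorem ext {x y : Points k A R} (h : ∀ a, x.hom a = y.hom a) : x = y :=
  WithConv.ofConv_injective (AlgHom.ext h)

instance : Monoid (Points k A R) := inferInstanceAs (Monoid (WithConv (A →ₐ[k] R)))

theorem one_hom (a : A) :
    (1 : Points k A R).hom a = algebraMap k R (Coalgebra.counit (R := k) a) := rfl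

theorem mul_hom (x y : Points k A R) (a : A) :
    (x * y).hom a = Algebra.TensorProduct.lift x.hom y.hom (fun _ _ => .all ..)
      (Coalgebra.comul (R := k) a) :=
  AlgHom.convMul_apply (R := k) (C := A) (A := R) x y a

theorem mul_hom_repr (x y : Points k A R) (a : A) {ι : Type*}
    (r : Coalgebra.Repr k a ι) :
    (x * y).hom a = ∑ i ∈ r.index, x.hom (r.left i) * y.hom (r.right i) := by
  rw [mul_hom, ← r.eq, map_sum]
  simp

/-- The inverse of a point is its composition with the antipode. -/
instance : Inv (Points k A R) := ⟨fun x => mk (x.hom.comp (HopfAlgebra.antipodeAlgHom k A))⟩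

theorem inv_hom (x : Points k A R) (a : A) :
    (x⁻¹).hom a = x.hom (HopfAlgebra.antipode k a) := rfl

instance : Group (Points k A R) where
  inv_mul_cancel x := by
    ext a
    rw [mul_hom_repr _ _ a (Coalgebra.Repr.arbitrary k a), one_hom]
    simp only [inv_hom, ← map_mul, ← map_sum]
    rw [HopfAlgebra.sum_antipode_mul_eq_algebraMap_counit, AlgHom.commutes]

/-- The group homomorphism `G(R) → G(S)` induced by a homomorphism `R → S` of `k`-algebras. -/
def map (f : R →ₐ[k] S) : Points k A R →* Points k A S where
  toFun x := mk (f.comp x.hom)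
  map_one' := by
    ext a
    change f ((1 : Points k A R).hom a) = _
    rw [one_hom, one_hom, AlgHom.commutes]
  map_mul' x y := by
    ext a
    rw [mul_hom_repr _ _ a (Coalgebra.Repr.arbitrary k a)]
    change f ((x * y).hom a) = _
    rw [mul_hom_repr _ _ a (Coalgebra.Repr.arbitrary k a), map_sum]
    simp only [map_mul]
    rfl

variable (k A R S) in
/-- `G(S)` regarded as a subgroup of `G(R)`, for an extension of `k`-algebras `R / S`. -/
def subgroupOver [Algebra S R] [IsScalarTower k S R] : Subgroup (Points k A R) :=
  (map (A := A) (IsScalarTower.toAlgHom k S R)).range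

end Group

section Topology

variable {k A R : Type*} [CommRing k] [CommRing A] [HopfAlgebra k A]
  [CommRing R] [Algebra k R] [TopologicalSpace R]

/-- The topology on `G(R)` for a topological ring `R`: the coarsest one for which every regular
function `a ∈ A` is continuous as a map `G(R) → R`. If `A` is generated by `a₁, …, aₙ`, this is the
subspace topology for the embedding `G(R) ⊆ Rⁿ` given by these generators. -/
instance : TopologicalSpace (Points k A R) :=
  TopologicalSpace.induced (fun x a => x.hom a) (Pi.topologicalSpace (ι := A) (Y := fun _ => R))

theorem continuous_hom (a : A) : Continuous (fun x : Points k A R => x.hom a) :=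
  (continuous_apply a).comp continuous_induced_dom

theorem continuous_iff {X : Type*} [TopologicalSpace X] {f : X → Points k A R} :
    Continuous f ↔ ∀ a : A, Continuous fun x => (f x).hom a := by
  rw [continuous_induced_rng, continuous_pi_iff]
  rfl

instance [IsTopologicalRing R] : IsTopologicalGroup (Points k A R) where
  continuous_mul := by
    rw [continuous_iff]
    intro a
    simp only [fun z : Points k A R × Points k A R =>
      mul_hom_repr z.1 z.2 a (Coalgebra.Repr.arbitrary k a)]
    exact continuous_finsetSum _ fun i _ =>
      ((continuous_hom _).comp continuous_fst).mul ((continuous_hom _).comp continuous_snd)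
  continuous_inv := by
    rw [continuous_iff]
    intro a
    simp only [inv_hom]
    exact continuous_hom _

end Topology

end Points

/-- The affine group scheme `Spec B` over a field `K` is unipotent: it is isomorphic to a closed
subgroup scheme of the group `Uₙ` of upper unitriangular matrices, for some `n`. A homomorphism
`Spec B → Uₙ` is an upper unitriangular matrix `u` over `B` with `Δ(uᵢⱼ) = ∑ₗ uᵢₗ ⊗ uₗⱼ` and
`ε(uᵢⱼ) = δᵢⱼ`, and it is a closed immersion if and only if its entries generate the algebra `B`. -/
def IsUnipotentOver (K B : Type*) [Field K] [CommRing B] [HopfAlgebra K B] : Prop :=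
  ∃ (n : ℕ) (u : Matrix (Fin n) (Fin n) B),
    (∀ i, u i i = 1) ∧ (∀ i j, j < i → u i j = 0) ∧
    (∀ i j, Coalgebra.comul (R := K) (u i j) = ∑ l, u i l ⊗ₜ[K] u l j) ∧
    (∀ i j, Coalgebra.counit (R := K) (u i j) = if i = j then 1 else 0) ∧
    Algebra.adjoin K (Set.range fun ij : Fin n × Fin n => u ij.1 ij.2) = ⊤

/-- `Spec A` is a unipotent algebraic `k`-group, where `k` is a ring with fraction field `K` (for
instance `k = ℤ` and `K = ℚ`): an affine group scheme of finite type over `k` whose generic fibre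
`Spec (K ⊗ A)` is a unipotent group over `K`. -/
structure IsUnipotentAlgebraicGroup (k K A : Type*) [CommRing k] [Field K] [Algebra k K]
    [CommRing A] [HopfAlgebra k A] : Prop where
  finiteType : Algebra.FiniteType k A
  unipotent : IsUnipotentOver K (K ⊗[k] A)

/-- The commensurability index `[H : H ∩ K] [K : H ∩ K]`, with the value `0` if one of the two
indices is infinite. -/
def comIndex {G : Type*} [Group G] (H K : Subgroup G) : ℕ :=
  K.relIndex H * H.relIndex K

section Lattices

variable (A : Type*) [CommRing A] [HopfAlgebra ℤ A]

/-- The arithmetic lattices of `G = Spec A`: the subgroups of `G(ℝ)` commensurable with `G(ℤ)`. -/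
def arithmeticLattices : Set (Subgroup (Points ℤ A ℝ)) :=
  {Δ | Δ.Commensurable (Points.subgroupOver ℤ A ℝ ℤ)}

/-- The arithmetic lattices with commensurability index `n` relative to `G(ℤ)`. -/
def arithmeticLatticesOfIndex (n : ℕ) : Set (Subgroup (Points ℤ A ℝ)) :=
  {Δ ∈ arithmeticLattices A | comIndex Δ (Points.subgroupOver ℤ A ℝ ℤ) = n}

/-- The closed subgroups `H` of `G(ℚ_p)` with commensurability index `n` relative to `G(ℤ_p)`. -/
def closedSubgroupsOfIndex (p : ℕ) [Fact p.Prime] (n : ℕ) : Set (Subgroup (Points ℤ A ℚ_[p])) :=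
  {H | IsClosed (H : Set (Points ℤ A ℚ_[p])) ∧ comIndex H (Points.subgroupOver ℤ A ℚ_[p] ℤ_[p]) = n}

/-- The closure in `G(ℚ_p)` of a subgroup `Δ` of `G(ℚ) ⊆ G(ℝ)`: the elements of `Δ` are viewed in
`G(ℚ)`, mapped to `G(ℚ_p)`, and the closure of the resulting subgroup is taken. (If `Δ` is not
contained in `G(ℚ)`, this is the closure of `Δ ∩ G(ℚ)`.) -/
def padicClosure (p : ℕ) [Fact p.Prime] (Δ : Subgroup (Points ℤ A ℝ)) :
    Subgroup (Points ℤ A ℚ_[p]) :=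
  ((Δ.comap (Points.map (A := A) (IsScalarTower.toAlgHom ℤ ℚ ℝ))).map
    (Points.map (A := A) (IsScalarTower.toAlgHom ℤ ℚ ℚ_[p]))).topologicalClosure

end Lattices

end

/-!
Every point `g` of a unipotent group over a field `K` of characteristic zero lies on a morphism
`t ↦ g ^ t` from the affine line (`Points.fieldPow`): evaluating regular functions at the entries
of a unitriangular representation shows that they are polynomial along the powers of `g`. Roots are
therefore unique, and they are continuous in `g` because the degrees are bounded independently
of `g` (`Points.continuous_fieldPow_left`). Moreover `g ^ t` is `q`-adically integral if `g` and `t`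
are (`Points.fieldPow_mem_subgroupOver_padicInt`), since the natural numbers are dense in `ℤ_q`.

Let `Δ` be an arithmetic lattice whose commensurability index relative to `G(ℤ)` is a power of `p`.
Its elements have positive powers in `G(ℤ)`, so by extraction of roots `Δ ≤ G(ℚ)`. The group `G(ℚ)`
is nilpotent, so a subgroup of index `p ^ a` contains all `p ^ a`-th powers
(`Subgroup.pow_relIndex_mem_of_isNilpotent`). Applied to `Δ ∩ G(ℤ)` in `Δ`, this shows that `Δ` lies
in `X = G(ℤ[1/p])` (`Points.le_integralAwayFrom`). Applied in `G(ℤ)`, it shows that `Δ` is open in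
`X` for the `p`-adic topology, since an element of `X` near `1` has a `p ^ b`-th root in `G(ℤ)`
(`Points.exists_isOpen_forall_mem`).

The group `X` is dense in `G(ℚ_p)` (`Points.dense_integralAwayFrom`). Indeed its closure is stable
under `t ↦ g ^ t` for `t ∈ ℚ_p` and hence contains `G(ℚ)`, each of whose elements has a positive
power in `G(ℤ)`; and `G(ℚ)` is dense in `G(ℚ_p)` because the exponential map from the Lie algebra
over `ℚ_p` is continuous and surjective, and the Lie algebra is spanned by rational elements
(`Points.dense_rational_points`).

For a dense subgroup `X` of a topological group, `H ↦ H ∩ X` and `Δ ↦ closure of Δ` are inverse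
bijections between the open subgroups of the group and those of `X`, and they preserve indices. As a
closed subgroup commensurable with the open subgroup `G(ℤ_p)` is open and `G(ℤ_p) ∩ X = G(ℤ)`, the
theorem follows.
-/

noncomputable section

/-! ### Convolution and the unitriangular representation -/

namespace Points

section Convolution

-- The base ring `k` stays general: for `k = ℤ`, instance search would equip `A` in `A →ₗ[ℤ] R` and
-- `ℚ ⊗[ℤ] A` with the module structure of its additive group instead of that of the Hopf algebra.
variable {k A R : Type*} [CommRing k] [CommRing A] [HopfAlgebra k A] [CommRing R] [Algebra k R]

/-- A point of `G(R)`, viewed in the convolution ring of `k`-linear maps `A → R`. -/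
def toLin : Points k A R →* WithConv (A →ₗ[k] R) where
  toFun g := WithConv.toConv g.hom.toLinearMap
  map_one' := rfl
  map_mul' g h := by
    ext a
    rw [(Coalgebra.Repr.arbitrary k a).convMul_apply]
    exact mul_hom_repr g h a _

theorem toLin_apply (g : Points k A R) (a : A) : toLin g a = g.hom a := rfl

end Convolution

end Points

section Hat

variable {k A K : Type*} [CommRing k] [Algebra k ℚ] [CommRing A] [HopfAlgebra k A]
  [Field K] [CharZero K] [Algebra k K] [IsScalarTower k ℚ K]

/-- The `ℚ`-linear extension to `ℚ ⊗ A` of a `k`-linear map from `A` to a field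
extension of `ℚ`. -/
def ratExtend (φ : WithConv (A →ₗ[k] K)) : ℚ ⊗[k] A →ₗ[ℚ] K :=
  φ.ofConv.liftBaseChange ℚ

@[simp] theorem ratExtend_tmul (φ : WithConv (A →ₗ[k] K)) (q : ℚ) (a : A) :
    ratExtend φ (q ⊗ₜ a) = q • φ a :=
  LinearMap.liftBaseChange_tmul ..

theorem ratExtend_add (φ ψ : WithConv (A →ₗ[k] K)) (b : ℚ ⊗[k] A) :
    ratExtend (φ + ψ) b = ratExtend φ b + ratExtend ψ b := by
  induction b with
  | zero => simp
  | add x y hx hy => simp only [map_add, hx, hy]; ring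
  | tmul q a => simp

theorem ratExtend_convOne (b : ℚ ⊗[k] A) :
    ratExtend (1 : WithConv (A →ₗ[k] K)) b = algebraMap ℚ K (Coalgebra.counit b) := by
  induction b with
  | zero => simp
  | add x y hx hy => simp only [map_add, hx, hy]
  | tmul q a => simp [Algebra.smul_def, mul_comm, IsScalarTower.algebraMap_apply k ℚ K]

theorem ratExtend_convMul (φ ψ : WithConv (A →ₗ[k] K)) (b : ℚ ⊗[k] A) :
    ratExtend (φ * ψ) b =
      LinearMap.mul' ℚ K (TensorProduct.map (ratExtend φ) (ratExtend ψ) (Coalgebra.comul b)) := by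
  induction b with
  | zero => simp
  | add x y hx hy => simp only [map_add, hx, hy]
  | tmul q a =>
    rw [ratExtend_tmul, TensorProduct.comul_tmul, LinearMap.convMul_apply, CommSemiring.comul_apply]
    generalize (Coalgebra.comul a : A ⊗[k] A) = z
    induction z with
    | zero => simp
    | add x y hx hy => simp only [map_add, TensorProduct.tmul_add, smul_add, hx, hy]
    | tmul x y => simp

/-- If `u` is a matrix of regular functions describing a homomorphism from `Spec (ℚ ⊗ A)` to a
general linear group, then evaluating linear maps at the entries of `u` is a homomorphism from
the convolution ring to a matrix ring. -/
def matrixEval {n : ℕ} (u : Matrix (Fin n) (Fin n) (ℚ ⊗[k] A))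
    (hmul : ∀ i j, Coalgebra.comul (R := ℚ) (u i j) = ∑ l, u i l ⊗ₜ[ℚ] u l j)
    (hone : ∀ i j, Coalgebra.counit (R := ℚ) (u i j) = if i = j then 1 else 0) :
    WithConv (A →ₗ[k] K) →+* Matrix (Fin n) (Fin n) K where
  toFun φ := Matrix.of fun i j => ratExtend φ (u i j)
  map_one' := by
    ext i j
    simp only [Matrix.of_apply, ratExtend_convOne, hone, Matrix.one_apply]
    split_ifs <;> simp
  map_mul' φ ψ := by
    ext i j
    simp [ratExtend_convMul, hmul, Matrix.mul_apply]
  map_zero' := by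
    ext i j
    have := ratExtend_add (0 : WithConv (A →ₗ[k] K)) 0 (u i j)
    simpa using this
  map_add' φ ψ := by
    ext i j
    simp [ratExtend_add]

theorem ratExtend_one_eq (φ : WithConv (A →ₗ[k] K)) : ratExtend φ 1 = φ 1 := by
  rw [Algebra.TensorProduct.one_def]; simp

end Hat

section Triangular

variable {n : ℕ} {K : Type*} [CommRing K]

/-- The matrices whose entries below the `k`-th superdiagonal vanish. -/
def bandMatrices (n : ℕ) (K : Type*) [CommRing K] (k : ℕ) :
    AddSubgroup (Matrix (Fin n) (Fin n) K) where
  carrier := {X | ∀ i j : Fin n, (j : ℕ) < i + k → X i j = 0}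
  zero_mem' _ _ _ := rfl
  add_mem' {X Y} hX hY i j h := by simp [hX i j h, hY i j h]
  neg_mem' {X} hX i j h := by simp [hX i j h]

theorem bandMatrices_mul {k l : ℕ} {X Y : Matrix (Fin n) (Fin n) K}
    (hX : X ∈ bandMatrices n K k) (hY : Y ∈ bandMatrices n K l) :
    X * Y ∈ bandMatrices n K (k + l) := by
  intro i j h
  rw [Matrix.mul_apply]
  refine Finset.sum_eq_zero fun m _ => ?_
  by_cases hm : (m : ℕ) < i + k
  · rw [hX i m hm, zero_mul]
  · rw [hY m j (by omega), mul_zero]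

theorem bandMatrices_pow {X : Matrix (Fin n) (Fin n) K} (hX : X ∈ bandMatrices n K 1) (k : ℕ) :
    X ^ k ∈ bandMatrices n K k := by
  induction k with
  | zero =>
    intro i j h
    rw [pow_zero, Matrix.one_apply_ne]
    rintro rfl
    omega
  | succ k ih => rw [pow_succ]; exact bandMatrices_mul ih hX

theorem bandMatrices_antitone {k l : ℕ} (h : k ≤ l) : bandMatrices n K l ≤ bandMatrices n K k :=
  fun _ hX i j hij => hX i j (by omega)

theorem bandMatrices_eq_zero {k : ℕ} (hk : n ≤ k) {X : Matrix (Fin n) (Fin n) K}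
    (hX : X ∈ bandMatrices n K k) : X = 0 := by
  ext i j
  exact hX i j (by omega)

theorem one_mem_bandMatrices : (1 : Matrix (Fin n) (Fin n) K) ∈ bandMatrices n K 0 := by
  intro i j h
  rw [Matrix.one_apply_ne]
  rintro rfl
  omega

/-- A group with a faithful upper unitriangular representation is nilpotent: the preimages of
`1 + bandMatrices n K (k + 1)` form a descending central series. -/
theorem Group.isNilpotent_of_unitriangular {G : Type*} [Group G]
    (ρ : G →* Matrix (Fin n) (Fin n) K) (hinj : Function.Injective ρ)
    (hρ : ∀ g, ρ g - 1 ∈ bandMatrices n K 1) : Group.IsNilpotent G := by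
  have h0 (g : G) : ρ g ∈ bandMatrices n K 0 := by
    simpa using add_mem (bandMatrices_antitone (Nat.zero_le 1) (hρ g)) one_mem_bandMatrices
  have hinv (g : G) : ρ g * ρ g⁻¹ = 1 := by rw [← map_mul, mul_inv_cancel, map_one]
  let H (k : ℕ) : Subgroup G :=
    { carrier := {g | ρ g - 1 ∈ bandMatrices n K (k + 1)}
      one_mem' := by simp [zero_mem]
      mul_mem' := fun {g h} hg hh => by
        have := add_mem (bandMatrices_mul hg (h0 h)) hh
        simpa [sub_mul] using this
      inv_mem' := fun {g} hg => by
        have := neg_mem (bandMatrices_mul hg (h0 g⁻¹))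
        simpa [sub_mul, hinv] using this }
  refine Subgroup.nilpotent_iff_finite_descending_central_series _ |>.mpr ⟨n, H, ⟨?_, ?_⟩, ?_⟩
  · exact eq_top_iff.mpr fun g _ => hρ g
  · intro x k hx g
    change ρ (x * g * x⁻¹ * g⁻¹) - 1 ∈ bandMatrices n K (k + 1 + 1)
    have h1 : (ρ x - 1) * (ρ g - 1) - (ρ g - 1) * (ρ x - 1) ∈ bandMatrices n K (k + 1 + 1) :=
      sub_mem (bandMatrices_mul hx (hρ g)) (add_comm 1 (k + 1) ▸ bandMatrices_mul (hρ g) hx)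
    have h2 := bandMatrices_mul h1 (h0 (x⁻¹ * g⁻¹))
    convert h2 using 1
    have h3 : ρ g * ρ x * ρ (x⁻¹ * g⁻¹) = 1 := by rw [← map_mul, ← map_mul]; simp
    have h4 : (ρ x - 1) * (ρ g - 1) - (ρ g - 1) * (ρ x - 1) = ρ x * ρ g - ρ g * ρ x := by
      noncomm_ring
    rw [h4, sub_mul, h3, ← map_mul, ← map_mul]
    simp [mul_assoc]
  · refine (Subgroup.eq_bot_iff_forall _).mpr fun g hg => hinj ?_
    rw [map_one]
    exact sub_eq_zero.mp (bandMatrices_eq_zero (Nat.le_succ n) hg)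

end Triangular

/-! ### Powers with exponents in a field of characteristic zero -/

theorem bandMatrices_one_add_pow {n : ℕ} {K : Type*} [CommRing K]
    {X : Matrix (Fin n) (Fin n) K} (hX : X ∈ bandMatrices n K 1) (N : ℕ) :
    (1 + X) ^ N = ∑ m ∈ Finset.range n, (N.choose m : K) • X ^ m := by
  have h (m : ℕ) (hm : n ≤ m) : X ^ m = 0 := bandMatrices_eq_zero hm (bandMatrices_pow hX m)
  have h1 : (1 + X) ^ N = ∑ m ∈ Finset.range (N + 1), (N.choose m : K) • X ^ m := by
    rw [add_comm, (Commute.one_right X).add_pow]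
    refine Finset.sum_congr rfl fun m _ => ?_
    rw [one_pow, mul_one, Nat.cast_smul_eq_nsmul, nsmul_eq_mul, (Nat.cast_commute _ _).eq]
  rw [h1]
  rcases le_total (N + 1) n with hn | hn
  · refine Finset.sum_subset (Finset.range_subset_range.mpr hn) fun m _ hm => ?_
    rw [Nat.choose_eq_zero_of_lt (by simpa using hm), Nat.cast_zero, zero_smul]
  · refine (Finset.sum_subset (Finset.range_subset_range.mpr hn) fun m _ hm => ?_).symm
    rw [h m (by simpa using hm), smul_zero]

theorem exists_polynomial_eval_eq_choose (K : Type*) [Field K] [CharZero K] (m : ℕ) :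
    ∃ P : Polynomial K, P.natDegree ≤ m ∧ ∀ N : ℕ, P.eval (N : K) = N.choose m := by
  refine ⟨Polynomial.C (m.factorial : K)⁻¹ * descPochhammer K m, ?_, fun N => ?_⟩
  · exact (Polynomial.natDegree_C_mul_le _ _).trans (descPochhammer_natDegree K m).le
  · rw [Polynomial.eval_mul, Polynomial.eval_C, descPochhammer_eval_eq_descFactorial,
      Nat.descFactorial_eq_factorial_mul_choose, Nat.cast_mul,
      inv_mul_cancel_left₀ (Nat.cast_ne_zero.mpr m.factorial_ne_zero)]

theorem Polynomial.eq_of_eval_natCast_eq {K : Type*} [Field K] [CharZero K] {P Q : Polynomial K}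
    (h : ∀ N : ℕ, P.eval (N : K) = Q.eval (N : K)) : P = Q := by
  refine Polynomial.eq_of_infinite_eval_eq _ _ ((Set.infinite_range_of_injective
    (Nat.cast_injective (R := K))).mono ?_)
  rintro _ ⟨N, rfl⟩
  exact h N

namespace Points

section Unique

variable {k A K : Type*} [CommRing k] [CommRing A] [HopfAlgebra k A] [Field K] [Algebra k K]

/-- Evaluation of polynomials at `t`, as a homomorphism of `k`-algebras. -/
def evalHom (k : Type*) {K : Type*} [CommRing k] [Field K] [Algebra k K] (t : K) :
    Polynomial K →ₐ[k] K :=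
  (Polynomial.aeval t).restrictScalars k

theorem evalHom_apply (t : K) (P : Polynomial K) : evalHom k t P = P.eval t := by
  simp [evalHom, Polynomial.aeval_def, Polynomial.eval₂_eq_eval_map]

theorem map_hom {R S : Type*} [CommRing R] [CommRing S] [Algebra k R] [Algebra k S]
    (f : R →ₐ[k] S) (g : Points k A R) (a : A) : (map f g).hom a = f (g.hom a) := rfl

theorem map_map {R S T : Type*} [CommRing R] [CommRing S] [CommRing T] [Algebra k R] [Algebra k S]
    [Algebra k T] (f : R →ₐ[k] S) (f' : S →ₐ[k] T) (g : Points k A R) :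
    map f' (map f g) = map (f'.comp f) g := rfl

theorem map_injective {R S : Type*} [CommRing R] [CommRing S] [Algebra k R] [Algebra k S]
    {f : R →ₐ[k] S} (hf : Function.Injective f) :
    Function.Injective (map (A := A) f) := fun g h hgh =>
  ext fun a => hf (by rw [← map_hom, hgh, map_hom])

/-- Morphisms from the affine line to `G` over a field of characteristic zero are determined by
their values at the natural numbers. -/
theorem eq_of_map_evalHom_natCast [CharZero K] {γ γ' : Points k A (Polynomial K)}
    (h : ∀ N : ℕ, map (evalHom k (N : K)) γ = map (evalHom k (N : K)) γ') : γ = γ' := by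
  ext1 a
  refine Polynomial.eq_of_eval_natCast_eq fun N => ?_
  have := congrArg (fun g => g.hom a) (h N)
  simpa only [map_hom, evalHom_apply] using this

end Unique

variable {k A K : Type*} [CommRing k] [Algebra k ℚ] [CommRing A] [HopfAlgebra k A]
  [Field K] [CharZero K] [Algebra k K] [IsScalarTower k ℚ K]

theorem ratExtend_toLin_mul (g : Points k A K) (b c : ℚ ⊗[k] A) :
    ratExtend (toLin g) (b * c) = ratExtend (toLin g) b * ratExtend (toLin g) c := by
  induction b with
  | zero => simp
  | add x y hx hy => simp only [add_mul, map_add, hx, hy]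
  | tmul q a =>
    induction c with
    | zero => simp
    | add x y hx hy => simp only [mul_add, map_add, hx, hy]
    | tmul r a' => simp [toLin_apply, Rat.smul_def]; ring

theorem sub_one_mem_bandMatrices {n : ℕ} {u : Matrix (Fin n) (Fin n) (ℚ ⊗[k] A)}
    (hdiag : ∀ i, u i i = 1) (hlow : ∀ i j, j < i → u i j = 0)
    (hmul : ∀ i j, Coalgebra.comul (R := ℚ) (u i j) = ∑ l, u i l ⊗ₜ[ℚ] u l j)
    (hone : ∀ i j, Coalgebra.counit (R := ℚ) (u i j) = if i = j then 1 else 0)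
    (g : Points k A K) : matrixEval u hmul hone (toLin g) - 1 ∈ bandMatrices n K 1 := by
  intro i j hij
  rcases (show j ≤ i by omega).eq_or_lt with rfl | h
  · simp [matrixEval, hdiag, ratExtend_one_eq, toLin_apply]
  · simp [matrixEval, hlow i j h, Matrix.one_apply_ne h.ne']

theorem isNilpotent_of_isUnipotentOver (hU : IsUnipotentOver ℚ (ℚ ⊗[k] A)) :
    Group.IsNilpotent (Points k A K) := by
  obtain ⟨n, u, hdiag, hlow, hmul, hone, hgen⟩ := hU
  refine Group.isNilpotent_of_unitriangular
    ((matrixEval u hmul hone : _ →+* Matrix (Fin n) (Fin n) K).toMonoidHom.comp toLin) ?_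
    (sub_one_mem_bandMatrices hdiag hlow hmul hone)
  intro g h hgh
  suffices key : ∀ b : ℚ ⊗[k] A, ratExtend (toLin g) b = ratExtend (toLin h) b by
    ext a
    simpa [toLin_apply] using key (1 ⊗ₜ a)
  intro b
  have hb : b ∈ Algebra.adjoin ℚ (Set.range fun ij : Fin n × Fin n => u ij.1 ij.2) := by
    rw [hgen]; trivial
  induction hb using Algebra.adjoin_induction with
  | mem b hb =>
    obtain ⟨⟨i, j⟩, rfl⟩ := hb
    exact congrFun (congrFun hgh i) j
  | algebraMap q => simp [Algebra.TensorProduct.algebraMap_apply, toLin_apply]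
  | add x y _ _ hx hy => rw [map_add, map_add, hx, hy]
  | mul x y _ _ hx hy => rw [ratExtend_toLin_mul, ratExtend_toLin_mul, hx, hy]

/-- In a unipotent group the regular functions depend polynomially on the exponent along the
powers of a point, with a degree bound that is uniform in the point. -/
theorem exists_polynomial_pow (hU : IsUnipotentOver ℚ (ℚ ⊗[k] A)) (K : Type*) [Field K] [CharZero K]
    [Algebra k K] [IsScalarTower k ℚ K] (a : A) :
    ∃ d : ℕ, ∀ g : Points k A K, ∃ P : Polynomial K, P.natDegree ≤ d ∧
      ∀ N : ℕ, (g ^ N).hom a = P.eval (N : K) := by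
  obtain ⟨n, u, hdiag, hlow, hmul, hone, hgen⟩ := hU
  suffices h : ∀ b : ℚ ⊗[k] A, ∃ d : ℕ, ∀ g : Points k A K, ∃ P : Polynomial K,
      P.natDegree ≤ d ∧ ∀ N : ℕ, ratExtend (toLin (g ^ N)) b = P.eval (N : K) by
    obtain ⟨d, hd⟩ := h (1 ⊗ₜ a)
    refine ⟨d, fun g => ?_⟩
    obtain ⟨P, hP, h⟩ := hd g
    refine ⟨P, hP, fun N => ?_⟩
    rw [← h N, ratExtend_tmul, one_smul, toLin_apply]
  intro b
  have hb : b ∈ Algebra.adjoin ℚ (Set.range fun ij : Fin n × Fin n => u ij.1 ij.2) := by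
    rw [hgen]; trivial
  induction hb using Algebra.adjoin_induction with
  | mem b hb =>
    obtain ⟨⟨i, j⟩, rfl⟩ := hb
    refine ⟨n, fun g => ?_⟩
    choose C hC hC' using exists_polynomial_eval_eq_choose K
    set X := matrixEval (K := K) u hmul hone (toLin g) - 1 with hX
    refine ⟨∑ m ∈ Finset.range n, Polynomial.C ((X ^ m) i j) * C m, ?_, fun N => ?_⟩
    · refine Polynomial.natDegree_sum_le_of_forall_le _ _ fun m hm => ?_
      exact ((Polynomial.natDegree_C_mul_le _ _).trans (hC m)).trans (Finset.mem_range.mp hm).le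
    · have h1 : matrixEval u hmul hone (toLin (g ^ N)) = (1 + X) ^ N := by
        rw [map_pow, map_pow, hX, add_sub_cancel]
      rw [bandMatrices_one_add_pow (sub_one_mem_bandMatrices hdiag hlow hmul hone g)] at h1
      have h2 := congrFun (congrFun h1 i) j
      simp only [Matrix.sum_apply, Matrix.smul_apply, smul_eq_mul] at h2
      change ratExtend (toLin (g ^ N)) (u i j) = _ at h2
      simp only [h2, Polynomial.eval_finsetSum, Polynomial.eval_mul, Polynomial.eval_C, hC']
      exact Finset.sum_congr rfl fun m _ => mul_comm _ _
  | algebraMap q =>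
    refine ⟨0, fun g => ⟨Polynomial.C (algebraMap ℚ K q), by simp, fun N => ?_⟩⟩
    rw [Algebra.TensorProduct.algebraMap_apply, ratExtend_tmul, toLin_apply]
    simp [Rat.smul_def]
  | add x y _ _ hx hy =>
    obtain ⟨d, hd⟩ := hx
    obtain ⟨e, he⟩ := hy
    refine ⟨max d e, fun g => ?_⟩
    obtain ⟨P, hP, hP'⟩ := hd g
    obtain ⟨Q, hQ, hQ'⟩ := he g
    exact ⟨P + Q, Polynomial.natDegree_add_le_of_le hP hQ, fun N => by
      rw [map_add, hP', hQ', Polynomial.eval_add]⟩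
  | mul x y _ _ hx hy =>
    obtain ⟨d, hd⟩ := hx
    obtain ⟨e, he⟩ := hy
    refine ⟨d + e, fun g => ?_⟩
    obtain ⟨P, hP, hP'⟩ := hd g
    obtain ⟨Q, hQ, hQ'⟩ := he g
    exact ⟨P * Q, Polynomial.natDegree_mul_le_of_le hP hQ,
      fun N => by
      rw [ratExtend_toLin_mul, hP', hQ', Polynomial.eval_mul]⟩

/-- Through every point `g` of a unipotent group passes a morphism from the affine line whose value
at each natural number `N` is `g ^ N`. -/
theorem exists_oneParameter (hU : IsUnipotentOver ℚ (ℚ ⊗[k] A)) (g : Points k A K) :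
    ∃ γ : Points k A (Polynomial K), ∀ N : ℕ, map (evalHom k (N : K)) γ = g ^ N := by
  have h (a : A) : ∃ P : Polynomial K, ∀ N : ℕ, P.eval (N : K) = (g ^ N).hom a := by
    obtain ⟨d, hd⟩ := exists_polynomial_pow hU K a
    obtain ⟨P, -, hP⟩ := hd g
    exact ⟨P, fun N => (hP N).symm⟩
  choose P hP using h
  let γ : A →ₐ[k] Polynomial K :=
    { toFun := P
      map_one' := Polynomial.eq_of_eval_natCast_eq fun N => by simp [hP]
      map_mul' := fun a b => Polynomial.eq_of_eval_natCast_eq fun N => by simp [hP]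
      map_zero' := Polynomial.eq_of_eval_natCast_eq fun N => by simp [hP]
      map_add' := fun a b => Polynomial.eq_of_eval_natCast_eq fun N => by simp [hP]
      commutes' := fun r => Polynomial.eq_of_eval_natCast_eq fun N => by
        simp [hP, IsScalarTower.algebraMap_apply k K (Polynomial K)] }
  refine ⟨mk γ, fun N => ?_⟩
  ext a
  rw [map_hom, evalHom_apply]
  exact hP a N

/-- The morphism from the affine line to a unipotent group that interpolates the powers of `g`. -/
def oneParameter (hU : IsUnipotentOver ℚ (ℚ ⊗[k] A)) (g : Points k A K) :
    Points k A (Polynomial K) :=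
  (exists_oneParameter hU g).choose

/-- The power `g ^ t` of a point of a unipotent group over a field of characteristic zero, with an
exponent `t` in that field. -/
def fieldPow (hU : IsUnipotentOver ℚ (ℚ ⊗[k] A)) (g : Points k A K) (t : K) : Points k A K :=
  map (evalHom k t) (oneParameter hU g)

variable (hU : IsUnipotentOver ℚ (ℚ ⊗[k] A))

theorem fieldPow_hom (g : Points k A K) (t : K) (a : A) :
    (fieldPow hU g t).hom a = ((oneParameter hU g).hom a).eval t :=
  evalHom_apply (k := k) t _

theorem fieldPow_natCast (g : Points k A K) (N : ℕ) : fieldPow hU g (N : K) = g ^ N :=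
  (exists_oneParameter hU g).choose_spec N

theorem fieldPow_one (g : Points k A K) : fieldPow hU g 1 = g := by
  simpa using fieldPow_natCast hU g 1

theorem fieldPow_zero (g : Points k A K) : fieldPow hU g 0 = 1 := by
  simpa using fieldPow_natCast hU g 0

theorem fieldPow_eq_map {g : Points k A K} {γ : Points k A (Polynomial K)}
    (h : ∀ N : ℕ, map (evalHom k (N : K)) γ = g ^ N) (t : K) :
    fieldPow hU g t = map (evalHom k t) γ := by
  rw [fieldPow, eq_of_map_evalHom_natCast fun N => ((fieldPow_natCast hU g N).trans (h N).symm)]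

theorem exists_algebraMap_eq_eval_zero (g : Points k A K) (a : A) :
    ∃ r : k, algebraMap k K r = ((oneParameter hU g).hom a).eval 0 :=
  ⟨_, by rw [← fieldPow_hom, fieldPow_zero, one_hom]⟩

/-- The substitution `X ↦ Q` in polynomials, as a homomorphism of `k`-algebras. -/
def substHom (k : Type*) {K : Type*} [CommRing k] [Field K] [Algebra k K] (Q : Polynomial K) :
    Polynomial K →ₐ[k] Polynomial K :=
  (Polynomial.aeval Q).restrictScalars k

omit [Algebra k ℚ] [CharZero K] [IsScalarTower k ℚ K] in
theorem evalHom_comp_substHom (t : K) (Q : Polynomial K) :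
    (evalHom k t).comp (substHom k Q) = evalHom k (Q.eval t) := by
  refine AlgHom.ext fun P => ?_
  rw [AlgHom.comp_apply, evalHom_apply, evalHom_apply, ← Polynomial.eval_comp,
    Polynomial.comp_eq_aeval]
  rfl

theorem fieldPow_pow (g : Points k A K) (m : ℕ) (t : K) :
    fieldPow hU (g ^ m) t = fieldPow hU g (m * t) := by
  rw [fieldPow_eq_map hU (γ := map (substHom k (Polynomial.C (m : K) * Polynomial.X))
    (oneParameter hU g)), map_map, evalHom_comp_substHom, fieldPow]
  · simp
  · intro N
    rw [map_map, evalHom_comp_substHom, ← pow_mul, ← fieldPow_natCast hU, fieldPow]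
    simp

theorem pow_fieldPow (g : Points k A K) (m : ℕ) (t : K) :
    fieldPow hU g t ^ m = fieldPow hU g (m * t) := by
  rw [← fieldPow_pow, fieldPow_eq_map hU (g := g ^ m) (γ := oneParameter hU g ^ m), map_pow,
    fieldPow]
  intro N
  rw [map_pow, ← pow_mul, mul_comm m, pow_mul, ← fieldPow_natCast hU g N, fieldPow]

theorem fieldPow_add (g : Points k A K) (s t : K) :
    fieldPow hU g (s + t) = fieldPow hU g s * fieldPow hU g t := by
  let const : K →ₐ[k] Polynomial K := IsScalarTower.toAlgHom k K (Polynomial K)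
  have hconst (r : K) : (evalHom k r).comp const = AlgHom.id k K := by
    ext x
    simp [const, evalHom]
  have hshift (r s : K) : map (evalHom k r) (map (substHom k (Polynomial.X + Polynomial.C s))
      (oneParameter hU g)) = fieldPow hU g (r + s) := by
    rw [map_map, evalHom_comp_substHom, fieldPow]
    simp
  have hid (x : Points k A K) : map (AlgHom.id k K) x = x := rfl
  -- The identity extends from natural numbers to the field in one exponent at a time.
  have h1 (M : ℕ) (t : K) : fieldPow hU g (t + M) = fieldPow hU g t * g ^ M := by
    have h : map (substHom k (Polynomial.X + Polynomial.C (M : K))) (oneParameter hU g) =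
        oneParameter hU g * map const (g ^ M) := by
      refine eq_of_map_evalHom_natCast fun N => ?_
      rw [hshift, map_mul, map_map, hconst, hid, ← Nat.cast_add, fieldPow_natCast, pow_add,
        ← fieldPow_natCast hU g N, fieldPow]
    rw [← hshift, h, map_mul, map_map, hconst, hid, fieldPow]
  have h2 : map (substHom k (Polynomial.X + Polynomial.C s)) (oneParameter hU g) =
      map const (fieldPow hU g s) * oneParameter hU g := by
    refine eq_of_map_evalHom_natCast fun N => ?_
    rw [hshift, map_mul, map_map, hconst, hid, add_comm, h1, ← fieldPow_natCast hU g N]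
    rfl
  rw [add_comm, ← hshift, h2, map_mul, map_map, hconst, hid]
  rfl

theorem map_fieldPow {L : Type*} [Field L] [CharZero L] [Algebra k L] [IsScalarTower k ℚ L]
    (f : K →ₐ[k] L) (g : Points k A K) (t : K) :
    map f (fieldPow hU g t) = fieldPow hU (map f g) (f t) := by
  have hf (s : K) : (evalHom k (f s)).comp (Polynomial.mapAlgHom f) = f.comp (evalHom k s) := by
    refine AlgHom.ext fun P => ?_
    simp only [AlgHom.comp_apply, evalHom_apply, Polynomial.coe_mapAlgHom]
    exact Polynomial.eval_map_apply (f := (f : K →+* L)) s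
  rw [fieldPow_eq_map hU (γ := map (Polynomial.mapAlgHom f) (oneParameter hU g)), map_map, hf]
  · rfl
  · intro N
    rw [map_map, ← map_natCast f N, hf, ← map_map, ← map_pow, ← fieldPow_natCast hU g N]
    rfl

/-- Roots in a unipotent group are unique: `g` is the power of `g ^ m` with exponent `1 / m`. -/
theorem fieldPow_pow_inv (g : Points k A K) {m : ℕ} (hm : m ≠ 0) :
    fieldPow hU (g ^ m) (m : K)⁻¹ = g := by
  rw [fieldPow_pow, mul_inv_cancel₀ (Nat.cast_ne_zero.mpr hm), fieldPow_one]

theorem fieldPow_inv_pow (g : Points k A K) {m : ℕ} (hm : m ≠ 0) :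
    fieldPow hU g (m : K)⁻¹ ^ m = g := by
  rw [pow_fieldPow, mul_inv_cancel₀ (Nat.cast_ne_zero.mpr hm), fieldPow_one]

section Topology

variable [TopologicalSpace K] [IsTopologicalRing K]

theorem continuous_fieldPow_right (g : Points k A K) : Continuous (fieldPow hU g) :=
  continuous_iff.mpr fun a => by
    simp only [fieldPow_hom]
    exact Polynomial.continuous _

/-- For a fixed exponent `t`, the power `g ^ t` is continuous in `g`: by the uniform degree bound,
Lagrange interpolation expresses its coordinates in terms of finitely many powers of `g` with
natural exponents. -/
theorem continuous_fieldPow_left (t : K) : Continuous fun g : Points k A K => fieldPow hU g t := by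
  refine continuous_iff.mpr fun a => ?_
  obtain ⟨d, hd⟩ := exists_polynomial_pow hU K a
  have hinj : Set.InjOn (fun i : ℕ => (i : K)) (Finset.range (d + 1)) :=
    fun _ _ _ _ h => Nat.cast_injective h
  have key (g : Points k A K) : (fieldPow hU g t).hom a = ∑ i ∈ Finset.range (d + 1),
      (g ^ i).hom a * (Lagrange.basis (Finset.range (d + 1)) (fun i : ℕ => (i : K)) i).eval t := by
    obtain ⟨P, hP, hP'⟩ := hd g
    have h1 : (oneParameter hU g).hom a = P := by
      refine Polynomial.eq_of_eval_natCast_eq fun N => ?_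
      rw [← fieldPow_hom, fieldPow_natCast, hP']
    have h2 := Lagrange.eq_interpolate_of_eval_eq (f := P) (fun i => (g ^ i).hom a) hinj
      (by
        rw [Finset.card_range]
        exact (Polynomial.degree_le_of_natDegree_le hP).trans_lt
          (WithBot.coe_lt_coe.mpr (Nat.lt_succ_self d)))
      (fun i _ => (hP' i).symm)
    rw [fieldPow_hom, h1, h2, Lagrange.interpolate_apply, Polynomial.eval_finsetSum]
    simp
  simp only [key]
  exact continuous_finsetSum _ fun i _ =>
    ((continuous_hom a).comp (continuous_pow i)).mul continuous_const

end Topology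

end Points

/-! ### Exponential and logarithm, and weak approximation -/

section CounitDerivation

variable {k A K : Type*} [CommRing k] [CommRing A] [HopfAlgebra k A]
  [Field K] [Algebra k K]

/-- The elements of the Lie algebra of `Spec A` over `K`: the linear maps `D : A → K` that satisfy
the Leibniz rule, where `A` acts on `K` through the counit. -/
def IsCounitDerivation (D : WithConv (A →ₗ[k] K)) : Prop :=
  ∀ a b : A, D (a * b) = algebraMap k K (Coalgebra.counit a) * D b +
    D a * algebraMap k K (Coalgebra.counit b)

theorem IsCounitDerivation.apply_one {D : WithConv (A →ₗ[k] K)} (hD : IsCounitDerivation D) :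
    D 1 = 0 := by
  simpa using hD 1 1

theorem IsCounitDerivation.pow_succ_apply_one {D : WithConv (A →ₗ[k] K)}
    (hD : IsCounitDerivation D) (m : ℕ) : (D ^ (m + 1)) 1 = 0 := by
  have := hD.apply_one
  rw [pow_succ, LinearMap.convMul_apply, Bialgebra.comul_one, Algebra.TensorProduct.one_def]
  simp [this]

/-- The formal exponential `∑ D ^ m X ^ m / m!`, where the powers are convolution powers. -/
def expSeries (D : WithConv (A →ₗ[k] K)) (a : A) : PowerSeries K :=
  PowerSeries.mk fun m => (D ^ m) a / m.factorial

/-- The coefficients of `expSeries` satisfy the differential equation `E' = E * D`. -/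
theorem coeff_succ_expSeries_mul [CharZero K] (D : WithConv (A →ₗ[k] K)) (a : A) (m : ℕ)
    {ι : Type*} (r : Coalgebra.Repr k a ι) :
    PowerSeries.coeff (m + 1) (expSeries D a) * (m + 1) =
      ∑ i ∈ r.index, PowerSeries.coeff m (expSeries D (r.left i)) * D (r.right i) := by
  have h1 : ((m : K) + 1) ≠ 0 := by exact_mod_cast Nat.succ_ne_zero m
  have h2 : (m.factorial : K) ≠ 0 := Nat.cast_ne_zero.mpr m.factorial_ne_zero
  simp only [expSeries, PowerSeries.coeff_mk, pow_succ D m, r.convMul_apply, Nat.factorial_succ,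
    Nat.cast_mul, Nat.cast_succ, Finset.sum_div, Finset.sum_mul]
  exact Finset.sum_congr rfl fun i _ => by field_simp

theorem expSeries_eq_sum_counit (D : WithConv (A →ₗ[k] K)) (a : A) {ι : Type*}
    (r : Coalgebra.Repr k a ι) :
    expSeries D a = ∑ i ∈ r.index,
      PowerSeries.C (algebraMap k K (Coalgebra.counit (r.right i))) * expSeries D (r.left i) := by
  ext m
  have h : (D ^ m) a = ∑ i ∈ r.index,
      (D ^ m) (r.left i) * algebraMap k K (Coalgebra.counit (r.right i)) := by
    conv_lhs => rw [← mul_one (D ^ m), r.convMul_apply]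
    rfl
  simp only [map_sum, PowerSeries.coeff_C_mul]
  simp only [expSeries, PowerSeries.coeff_mk, h, Finset.sum_div]
  exact Finset.sum_congr rfl fun i _ => by ring

theorem derivative_expSeries [CharZero K] (D : WithConv (A →ₗ[k] K)) (a : A) {ι : Type*}
    (r : Coalgebra.Repr k a ι) :
    PowerSeries.derivative K (expSeries D a) =
      ∑ i ∈ r.index, PowerSeries.C (D (r.right i)) * expSeries D (r.left i) := by
  ext m
  rw [PowerSeries.coeff_derivative, coeff_succ_expSeries_mul D a m r, map_sum]
  exact Finset.sum_congr rfl fun i _ => by rw [PowerSeries.coeff_C_mul, mul_comm]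

/-- The formal exponential of a derivation is multiplicative: `E (a * b)` and `E a * E b` satisfy
the same linear differential equation with the same initial value. -/
theorem IsCounitDerivation.expSeries_mul [CharZero K] {D : WithConv (A →ₗ[k] K)}
    (hD : IsCounitDerivation D) (a b : A) :
    expSeries D (a * b) = expSeries D a * expSeries D b := by
  suffices h : ∀ (m : ℕ) (a b : A), PowerSeries.coeff m (expSeries D (a * b)) =
      PowerSeries.coeff m (expSeries D a * expSeries D b) from PowerSeries.ext fun m => h m a b
  intro m
  induction m with
  | zero =>
    intro a b
    simp [expSeries, PowerSeries.coeff_zero_eq_constantCoeff]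
  | succ m ih =>
    intro a b
    obtain ⟨ι, r⟩ : Σ ι : Type _, Coalgebra.Repr k a ι := ⟨_, Coalgebra.Repr.arbitrary k a⟩
    obtain ⟨κ, s⟩ : Σ κ : Type _, Coalgebra.Repr k b κ := ⟨_, Coalgebra.Repr.arbitrary k b⟩
    have h1 : ((m : K) + 1) ≠ 0 := by exact_mod_cast Nat.succ_ne_zero m
    let t : Coalgebra.Repr k (a * b) (ι × κ) :=
      { index := r.index ×ˢ s.index
        left := fun x => r.left x.1 * s.left x.2
        right := fun x => r.right x.1 * s.right x.2
        eq := by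
          rw [Bialgebra.comul_mul, ← r.eq, ← s.eq, Finset.sum_mul_sum, Finset.sum_product]
          simp }
    refine mul_right_cancel₀ h1 ?_
    have h2 := PowerSeries.coeff_derivative (R := K) (expSeries D a * expSeries D b) m
    rw [coeff_succ_expSeries_mul D (a * b) m t, ← h2, Derivation.leibniz,
      derivative_expSeries D a r, derivative_expSeries D b s]
    conv_rhs =>
      enter [2]
      rw [expSeries_eq_sum_counit D a r, expSeries_eq_sum_counit D b s]
    simp only [smul_eq_mul, Finset.sum_mul_sum, map_add, map_sum]
    rw [Finset.sum_product, Finset.sum_comm (s := s.index), ← Finset.sum_add_distrib]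
    refine Finset.sum_congr rfl fun i _ => ?_
    rw [← Finset.sum_add_distrib]
    refine Finset.sum_congr rfl fun j _ => ?_
    change PowerSeries.coeff m (expSeries D (r.left i * s.left j)) * D (r.right i * s.right j) = _
    rw [hD, ih]
    have e1 (x y : K) (p q : PowerSeries K) : PowerSeries.C x * p * (PowerSeries.C y * q) =
        PowerSeries.C (x * y) * (p * q) := by rw [map_mul]; ring
    rw [e1, e1, PowerSeries.coeff_C_mul, PowerSeries.coeff_C_mul,
      mul_comm (expSeries D (s.left j))]
    ring

end CounitDerivation

section Exponential

variable {k A K : Type*} [CommRing k] [Algebra k ℚ] [CommRing A] [HopfAlgebra k A]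
  [Field K] [CharZero K] [Algebra k K] [IsScalarTower k ℚ K]

/-- The formal exponential of `D`, extended to `ℚ ⊗ A`, is multiplicative for a derivation `D`. -/
theorem IsCounitDerivation.mk_ratExtend_mul {D : WithConv (A →ₗ[k] K)}
    (hD : IsCounitDerivation D) (b c : ℚ ⊗[k] A) :
    (PowerSeries.mk fun m => ratExtend (D ^ m) (b * c) / (m.factorial : K)) =
      (PowerSeries.mk fun m => ratExtend (D ^ m) b / (m.factorial : K)) *
        PowerSeries.mk fun m => ratExtend (D ^ m) c / (m.factorial : K) := by
  have hadd (x y : ℚ ⊗[k] A) :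
      (PowerSeries.mk fun m => ratExtend (D ^ m) (x + y) / (m.factorial : K)) =
        (PowerSeries.mk fun m => ratExtend (D ^ m) x / (m.factorial : K)) +
          PowerSeries.mk fun m => ratExtend (D ^ m) y / (m.factorial : K) := by
    ext m
    simp [add_div]
  have htmul (q : ℚ) (a : A) :
      (PowerSeries.mk fun m => ratExtend (D ^ m) (q ⊗ₜ a) / (m.factorial : K)) =
        PowerSeries.C (q : K) * expSeries D a := by
    ext m
    rw [PowerSeries.coeff_C_mul, PowerSeries.coeff_mk, expSeries, PowerSeries.coeff_mk,
      ratExtend_tmul, Rat.smul_def, mul_div_assoc]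
  have hzero : (PowerSeries.mk fun m => ratExtend (D ^ m) 0 / (m.factorial : K)) = 0 := by
    ext m
    simp
  induction b with
  | zero => rw [zero_mul, hzero, zero_mul]
  | add x y hx hy => rw [add_mul, hadd, hadd, hx, hy, add_mul]
  | tmul q a =>
    induction c with
    | zero => rw [mul_zero, hzero, mul_zero]
    | add x y hx hy => rw [mul_add, hadd, hadd, hx, hy, mul_add]
    | tmul r a' =>
      rw [Algebra.TensorProduct.tmul_mul_tmul, htmul, htmul, htmul, hD.expSeries_mul, Rat.cast_mul,
        map_mul]
      ring

/-- The elements of the Lie algebra of a unipotent group are locally nilpotent for convolution,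
uniformly in the derivation. -/
theorem exists_pow_apply_eq_zero (hU : IsUnipotentOver ℚ (ℚ ⊗[k] A)) (K : Type*) [Field K]
    [CharZero K] [Algebra k K] [IsScalarTower k ℚ K] (a : A) :
    ∃ d : ℕ, ∀ D : WithConv (A →ₗ[k] K), IsCounitDerivation D → ∀ m, d ≤ m → (D ^ m) a = 0 := by
  obtain ⟨n, u, hdiag, hlow, hmul, hone, hgen⟩ := hU
  suffices h : ∀ b : ℚ ⊗[k] A, ∃ d : ℕ, ∀ D : WithConv (A →ₗ[k] K), IsCounitDerivation D →
      ∀ m, d ≤ m → ratExtend (D ^ m) b = 0 by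
    obtain ⟨d, hd⟩ := h (1 ⊗ₜ a)
    refine ⟨d, fun D hD m hm => ?_⟩
    rw [← hd D hD m hm, ratExtend_tmul, one_smul]
  intro b
  have hb : b ∈ Algebra.adjoin ℚ (Set.range fun ij : Fin n × Fin n => u ij.1 ij.2) := by
    rw [hgen]; trivial
  induction hb using Algebra.adjoin_induction with
  | mem b hb =>
    obtain ⟨⟨i, j⟩, rfl⟩ := hb
    refine ⟨n, fun D hD m hm => ?_⟩
    have hX : matrixEval u hmul hone D ∈ bandMatrices n K 1 := by
      intro i j hij
      rcases (show j ≤ i by omega).eq_or_lt with rfl | h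
      · simp [matrixEval, hdiag, ratExtend_one_eq, hD.apply_one]
      · simp [matrixEval, hlow i j h]
    have h1 : matrixEval u hmul hone (D ^ m) = 0 := by
      rw [map_pow]
      exact bandMatrices_eq_zero hm (bandMatrices_pow hX m)
    exact congrFun (congrFun h1 i) j
  | algebraMap q =>
    refine ⟨1, fun D hD m hm => ?_⟩
    obtain ⟨m, rfl⟩ := Nat.exists_eq_add_of_le' hm
    rw [Algebra.TensorProduct.algebraMap_apply, ratExtend_tmul, hD.pow_succ_apply_one, smul_zero]
  | add x y _ _ hx hy =>
    obtain ⟨d, hd⟩ := hx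
    obtain ⟨e, he⟩ := hy
    refine ⟨max d e, fun D hD m hm => ?_⟩
    rw [map_add, hd D hD m (le_of_max_le_left hm), he D hD m (le_of_max_le_right hm), add_zero]
  | mul x y _ _ hx hy =>
    obtain ⟨d, hd⟩ := hx
    obtain ⟨e, he⟩ := hy
    refine ⟨d + e, fun D hD m hm => ?_⟩
    have h := congrArg (PowerSeries.coeff m) (hD.mk_ratExtend_mul x y)
    rw [PowerSeries.coeff_mk, PowerSeries.coeff_mul] at h
    have h2 : (m.factorial : K) ≠ 0 := Nat.cast_ne_zero.mpr m.factorial_ne_zero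
    refine (div_eq_zero_iff.mp (h.trans (Finset.sum_eq_zero fun ij hij => ?_))).resolve_right h2
    have hij' := Finset.HasAntidiagonal.mem_antidiagonal.mp hij
    simp only [PowerSeries.coeff_mk]
    rcases le_or_gt d ij.1 with h1 | h1
    · rw [hd D hD _ h1, zero_div, zero_mul]
    · rw [he D hD ij.2 (by omega), zero_div, mul_zero]

namespace Points

/-- The exponential series of an element of the Lie algebra defines a point. The number of terms
summed is immaterial, as long as the omitted ones vanish. -/
theorem exists_exp (hU : IsUnipotentOver ℚ (ℚ ⊗[k] A)) {D : WithConv (A →ₗ[k] K)}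
    (hD : IsCounitDerivation D) :
    ∃ g : Points k A K, ∀ (a : A) (d : ℕ), (∀ m, d ≤ m → (D ^ m) a = 0) →
      g.hom a = ∑ m ∈ Finset.range d, (D ^ m) a / (m.factorial : K) := by
  choose d hd using exists_pow_apply_eq_zero hU K
  -- By local nilpotence the formal exponential is a polynomial, which can be evaluated at `1`.
  let P (a : A) : Polynomial K := PowerSeries.trunc (d a) (expSeries D a)
  have hP (a : A) : (P a : PowerSeries K) = expSeries D a := by
    ext m
    rw [Polynomial.coeff_coe, PowerSeries.coeff_trunc]
    split_ifs with h
    · rfl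
    · rw [expSeries, PowerSeries.coeff_mk, hd a D hD m (not_lt.mp h), zero_div]
  have hP1 (a : A) (n : ℕ) (hn : ∀ m, n ≤ m → (D ^ m) a = 0) :
      P a = PowerSeries.trunc n (expSeries D a) := by
    refine Polynomial.coe_injective K ?_
    rw [hP]
    ext m
    rw [Polynomial.coeff_coe, PowerSeries.coeff_trunc]
    split_ifs with h
    · rfl
    · rw [expSeries, PowerSeries.coeff_mk, hn m (not_lt.mp h), zero_div]
  have hadd (a b : A) : P (a + b) = P a + P b := by
    refine Polynomial.coe_injective K ?_
    rw [Polynomial.coe_add, hP, hP, hP]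
    ext m
    simp [expSeries, add_div]
  have hmul (a b : A) : P (a * b) = P a * P b := by
    refine Polynomial.coe_injective K ?_
    rw [Polynomial.coe_mul, hP, hP, hP, hD.expSeries_mul]
  have hsmul (r : k) : P (algebraMap k A r) = algebraMap k (Polynomial K) r := by
    refine Polynomial.coe_injective K ?_
    rw [hP, IsScalarTower.algebraMap_apply k K (Polynomial K), Polynomial.algebraMap_apply,
      Algebra.algebraMap_self_apply, Polynomial.coe_C]
    ext m
    rw [Algebra.algebraMap_eq_smul_one, expSeries, PowerSeries.coeff_mk, map_smul,
      PowerSeries.coeff_C]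
    cases m with
    | zero => simp [Algebra.smul_def]
    | succ m => simp [hD.pow_succ_apply_one]
  let φ : A →ₐ[k] Polynomial K := AlgHom.ofLinearMap
    { toFun := P
      map_add' := hadd
      map_smul' := fun r a => by
        rw [Algebra.smul_def, hmul, hsmul, RingHom.id_apply, Algebra.smul_def] }
    (by simpa using hsmul 1) hmul
  refine ⟨map (evalHom k 1) (mk φ), fun a n hn => ?_⟩
  rw [map_hom, evalHom_apply]
  change (P a).eval 1 = _
  rw [hP1 a n hn, Polynomial.eval, PowerSeries.eval₂_trunc_eq_sum_range]
  simp [expSeries]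

/-- The exponential of an element of the Lie algebra of a unipotent group. -/
def exp (hU : IsUnipotentOver ℚ (ℚ ⊗[k] A)) {D : WithConv (A →ₗ[k] K)}
    (hD : IsCounitDerivation D) : Points k A K :=
  (exists_exp hU hD).choose

theorem exp_hom (hU : IsUnipotentOver ℚ (ℚ ⊗[k] A)) {D : WithConv (A →ₗ[k] K)}
    (hD : IsCounitDerivation D) {a : A} {d : ℕ} (hd : ∀ m, d ≤ m → (D ^ m) a = 0) :
    (exp hU hD).hom a = ∑ m ∈ Finset.range d, (D ^ m) a / (m.factorial : K) :=
  (exists_exp hU hD).choose_spec a d hd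

/-- Every point of a unipotent group is an exponential: its logarithm is the tangent vector at `0`
of the one-parameter subgroup through it. -/
theorem exists_exp_eq (hU : IsUnipotentOver ℚ (ℚ ⊗[k] A)) (g : Points k A K) :
    ∃ (D : WithConv (A →ₗ[k] K)) (hD : IsCounitDerivation D), exp hU hD = g := by
  set γ := oneParameter hU g with hγ
  have hγ0 (a : A) : (γ.hom a).eval 0 = algebraMap k K (Coalgebra.counit a) := by
    rw [hγ, ← fieldPow_hom, fieldPow_zero, one_hom]
  let D : WithConv (A →ₗ[k] K) := WithConv.toConv
    ((evalHom k 0).toLinearMap ∘ₗ Polynomial.derivative.restrictScalars k ∘ₗ γ.hom.toLinearMap)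
  have hDa (a : A) : D a = (Polynomial.derivative (γ.hom a)).eval 0 := evalHom_apply (k := k) 0 _
  have hD : IsCounitDerivation D := by
    intro a b
    simp only [hDa, map_mul, Polynomial.derivative_mul, Polynomial.eval_add, Polynomial.eval_mul,
      hγ0]
    ring
  -- Differentiating `g ^ (t + s) = g ^ t * g ^ s` at `s = 0`.
  have hderiv (a : A) {ι : Type _} (r : Coalgebra.Repr k a ι) :
      Polynomial.derivative (γ.hom a) =
        ∑ i ∈ r.index, Polynomial.C (D (r.right i)) * γ.hom (r.left i) := by
    refine Polynomial.funext fun t => ?_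
    have h : (γ.hom a).comp (Polynomial.X + Polynomial.C t) =
        ∑ i ∈ r.index, Polynomial.C ((γ.hom (r.left i)).eval t) * γ.hom (r.right i) := by
      refine Polynomial.funext fun s => ?_
      rw [Polynomial.eval_comp, Polynomial.eval_add, Polynomial.eval_X, Polynomial.eval_C, hγ,
        ← fieldPow_hom, add_comm, fieldPow_add, mul_hom_repr _ _ a r, Polynomial.eval_finsetSum]
      exact Finset.sum_congr rfl fun i _ => by
        rw [Polynomial.eval_mul, Polynomial.eval_C, fieldPow_hom, fieldPow_hom]
    have h' := congrArg (fun P => (Polynomial.derivative P).eval 0) h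
    simp only [Polynomial.derivative_comp, Polynomial.derivative_sum, Polynomial.derivative_mul,
      Polynomial.derivative_C, zero_mul, zero_add, Polynomial.eval_finsetSum, Polynomial.eval_mul,
      Polynomial.eval_C, ← hDa, Polynomial.derivative_add, Polynomial.derivative_X, add_zero,
      Polynomial.eval_comp, Polynomial.eval_add, Polynomial.eval_X, one_mul] at h'
    rw [h', Polynomial.eval_finsetSum]
    exact Finset.sum_congr rfl fun i _ => by rw [Polynomial.eval_mul, Polynomial.eval_C, mul_comm]
  have hiter (m : ℕ) : ∀ a, (D ^ m) a = (Polynomial.derivative^[m] (γ.hom a)).eval 0 := by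
    induction m with
    | zero => intro a; rw [pow_zero, Function.iterate_zero_apply, hγ0]; rfl
    | succ m ih =>
      intro a
      let r := Coalgebra.Repr.arbitrary k a
      rw [pow_succ, r.convMul_apply, Function.iterate_succ_apply, hderiv a r,
        Polynomial.iterate_derivative_sum, Polynomial.eval_finsetSum]
      refine Finset.sum_congr rfl fun i _ => ?_
      rw [Polynomial.iterate_derivative_C_mul, Polynomial.eval_mul, Polynomial.eval_C, ih, mul_comm]
  have hcoeff (m : ℕ) (a : A) : (D ^ m) a / (m.factorial : K) = (γ.hom a).coeff m := by
    rw [hiter, ← Polynomial.coeff_zero_eq_eval_zero, Polynomial.coeff_iterate_derivative, zero_add,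
      Nat.descFactorial_self, nsmul_eq_mul,
      mul_div_cancel_left₀ _ (Nat.cast_ne_zero.mpr m.factorial_ne_zero)]
  refine ⟨D, hD, ?_⟩
  ext a
  rw [exp_hom hU hD (d := (γ.hom a).natDegree + 1)]
  · conv_rhs => rw [← fieldPow_one hU g, fieldPow_hom, ← hγ, Polynomial.eval_eq_sum_range]
    exact Finset.sum_congr rfl fun m _ => by rw [hcoeff, one_pow, mul_one]
  · intro m hm
    have h := hcoeff m a
    rw [Polynomial.coeff_eq_zero_of_natDegree_lt (by omega)] at h
    exact (div_eq_zero_iff.mp h).resolve_right (Nat.cast_ne_zero.mpr m.factorial_ne_zero)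

end Points

end Exponential

namespace Points

theorem mem_range_map_iff {k A R S : Type*} [CommRing k] [CommRing A] [HopfAlgebra k A]
    [CommRing R] [CommRing S] [Algebra k R] [Algebra k S] {f : R →ₐ[k] S}
    (hf : Function.Injective f) {x : Points k A S} :
    x ∈ (map (A := A) f).range ↔ ∀ a, ∃ r, f r = x.hom a := by
  constructor
  · rintro ⟨y, rfl⟩ a
    exact ⟨y.hom a, rfl⟩
  · intro h
    refine ⟨mk ((AlgEquiv.ofInjective f hf).symm.toAlgHom.comp (x.hom.codRestrict f.range h)), ?_⟩
    ext a
    exact congrArg Subtype.val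
      ((AlgEquiv.ofInjective f hf).apply_symm_apply (x.hom.codRestrict f.range h a))

section WeakApproximation

variable {k A K : Type*} [CommRing k] [Algebra k ℚ] [CommRing A] [HopfAlgebra k A]
  [Field K] [CharZero K] [Algebra k K] [IsScalarTower k ℚ K]

/-- Weak approximation for unipotent groups: if `ℚ` is dense in `K`, then the points with rational
coordinates are dense in `G(K)`. The logarithm `D` of a point takes its values in a
finite-dimensional `ℚ`-subspace of `K`, so it is a combination of rational derivations with
coefficients in `K`; approximate these coefficients by rational numbers. -/
theorem dense_rational_points (hU : IsUnipotentOver ℚ (ℚ ⊗[k] A)) (hA : Algebra.FiniteType k A)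
    [TopologicalSpace K] [IsTopologicalRing K] (hK : DenseRange ((↑) : ℚ → K)) :
    Dense {x : Points k A K | ∀ a, ∃ q : ℚ, (q : K) = x.hom a} := by
  intro g
  obtain ⟨D, hD, rfl⟩ := exists_exp_eq hU g
  obtain ⟨S, hS⟩ := hA
  let W : Submodule ℚ K := Submodule.span ℚ ((fun a => D a) '' (S : Set A))
  have hcast (r : k) : algebraMap k K r = ((algebraMap k ℚ r : ℚ) : K) := by
    rw [IsScalarTower.algebraMap_apply k ℚ K, eq_ratCast]
  have hDW (a : A) : D a ∈ W := by
    have ha : a ∈ Algebra.adjoin k (S : Set A) := by rw [hS]; trivial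
    induction ha using Algebra.adjoin_induction with
    | mem x hx => exact Submodule.subset_span ⟨x, hx, rfl⟩
    | algebraMap r =>
      rw [Algebra.algebraMap_eq_smul_one, map_smul, hD.apply_one, smul_zero]
      exact zero_mem W
    | add x y _ _ hx hy => rw [map_add]; exact add_mem hx hy
    | mul x y _ _ hx hy =>
      rw [hD, hcast, hcast, mul_comm (D x), ← Rat.smul_def, ← Rat.smul_def]
      exact add_mem (W.smul_mem _ hy) (W.smul_mem _ hx)
  have : FiniteDimensional ℚ W :=
    FiniteDimensional.span_of_finite ℚ (S.finite_toSet.image _)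
  let b := Module.finBasis ℚ W
  choose f hf using fun j => LinearMap.exists_extend (b.coord j)
  -- `E r` is the combination of the coordinates of `D` with coefficients `r`.
  let E (r : Fin (Module.finrank ℚ W) → K) : WithConv (A →ₗ[k] K) := WithConv.toConv
    (∑ j, LinearMap.mulLeft k (r j) ∘ₗ (Algebra.linearMap ℚ K).restrictScalars k ∘ₗ
      (f j).restrictScalars k ∘ₗ D.ofConv)
  have hE (r) (a : A) : E r a = ∑ j, r j * (f j (D a) : ℚ) := by
    change (∑ j, _ : A →ₗ[k] K) a = _
    simp only [LinearMap.sum_apply]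
    exact Finset.sum_congr rfl fun j _ => by
      rw [← eq_ratCast (algebraMap ℚ K)]; rfl
  have hEder (r) : IsCounitDerivation (E r) := by
    intro x y
    simp only [hE, Finset.mul_sum, Finset.sum_mul, ← Finset.sum_add_distrib]
    refine Finset.sum_congr rfl fun j _ => ?_
    rw [hD, hcast, hcast, mul_comm (D x), ← Rat.smul_def, ← Rat.smul_def, map_add, map_smul,
      map_smul, smul_eq_mul, smul_eq_mul]
    push_cast
    ring
  have hED : E (fun j => (b j : K)) = D := by
    refine WithConv.ext (LinearMap.ext fun a => ?_)
    have h := congrArg Subtype.val (b.sum_repr ⟨D a, hDW a⟩)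
    rw [hE]
    rw [AddSubmonoidClass.coe_finsetSum] at h
    refine Eq.trans (Finset.sum_congr rfl fun j _ => ?_) h
    have h2 : f j (D a) = b.repr ⟨D a, hDW a⟩ j := LinearMap.congr_fun (hf j) ⟨D a, hDW a⟩
    rw [h2, Submodule.coe_smul, Rat.smul_def, mul_comm]
  have hcontpow (m : ℕ) : ∀ a, Continuous fun r => ((E r) ^ m) a := by
    induction m with
    | zero => intro a; simp only [pow_zero]; exact continuous_const
    | succ m ih =>
      intro a
      simp only [pow_succ, (Coalgebra.Repr.arbitrary k a).convMul_apply, hE]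
      exact continuous_finsetSum _ fun i _ => (ih _).mul
        (continuous_finsetSum _ fun j _ => (continuous_apply j).mul continuous_const)
  have hratpow (s : Fin (Module.finrank ℚ W) → ℚ) (m : ℕ) :
      ∀ a, ∃ q : ℚ, (q : K) = ((E fun j => (s j : K)) ^ m) a := by
    induction m with
    | zero => exact fun a => ⟨algebraMap k ℚ (Coalgebra.counit a), (hcast _).symm⟩
    | succ m ih =>
      intro a
      choose q hq using ih
      refine ⟨∑ i ∈ (Coalgebra.Repr.arbitrary k a).index,
        q ((Coalgebra.Repr.arbitrary k a).left i) *
          ∑ j, s j * f j (D ((Coalgebra.Repr.arbitrary k a).right i)), ?_⟩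
      simp only [pow_succ, (Coalgebra.Repr.arbitrary k a).convMul_apply, hE, ← hq]
      push_cast
      rfl
  choose d hd using exists_pow_apply_eq_zero hU K
  have hexp (r) (a : A) : (exp hU (hEder r)).hom a =
      ∑ m ∈ Finset.range (d a), ((E r) ^ m) a / (m.factorial : K) :=
    exp_hom hU (hEder r) (hd a _ (hEder r))
  have hcont : Continuous fun r => exp hU (hEder r) := by
    refine continuous_iff.mpr fun a => ?_
    simp only [hexp]
    exact continuous_finsetSum _ fun m _ => (hcontpow m a).div_const _
  have hdense : DenseRange fun (s : Fin (Module.finrank ℚ W) → ℚ) j => (s j : K) :=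
    DenseRange.piMap fun _ => hK
  have hD' : exp hU hD = exp hU (hEder fun j => (b j : K)) := by
    congr 1
    exact hED.symm
  rw [hD']
  refine map_mem_closure (f := fun r => exp hU (hEder r)) hcont (hdense fun j => (b j : K)) ?_
  rintro _ ⟨s, rfl⟩ a
  choose q hq using hratpow s
  refine ⟨∑ m ∈ Finset.range (d a), q m a / m.factorial, ?_⟩
  rw [hexp]
  push_cast
  exact Finset.sum_congr rfl fun m _ => by rw [hq]

end WeakApproximation

end Points

/-! ### Indices and closures of subgroups -/

namespace Subgroup

/-- In a nilpotent group, the index of a subgroup of finite index is an exponent of the group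
relative to that subgroup, even if it is not normal, because it is properly contained in its
normalizer. -/
theorem pow_index_mem_of_isNilpotent {G : Type*} [Group G] [Group.IsNilpotent G] (H : Subgroup G)
    (hH : H.index ≠ 0) (g : G) : g ^ H.index ∈ H := by
  induction h : H.index using Nat.strong_induction_on generalizing H with
  | _ n ih =>
    subst h
    rcases eq_or_ne H ⊤ with rfl | htop
    · trivial
    have hlt : H < normalizer (H : Set G) :=
      Group.normalizerCondition_of_isNilpotent H (lt_top_iff_ne_top.mpr htop)
    have hmul := relIndex_mul_index hlt.le
    have hN0 : (normalizer (H : Set G)).index ≠ 0 := fun h0 => hH (by rw [← hmul, h0, mul_zero])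
    have hrel0 : H.relIndex (normalizer (H : Set G)) ≠ 0 := fun h0 =>
      hH (by rw [← hmul, h0, zero_mul])
    have hrel1 : H.relIndex (normalizer (H : Set G)) ≠ 1 := fun h1 =>
      hlt.not_ge (relIndex_eq_one.mp h1)
    have hNlt : (normalizer (H : Set G)).index < H.index := by
      rw [← hmul]
      exact lt_mul_of_one_lt_left (Nat.pos_of_ne_zero hN0) (by omega)
    have h1 := ih _ hNlt _ hN0 rfl
    have h2 := pow_index_mem (H.subgroupOf (normalizer (H : Set G)))
      ⟨g ^ (normalizer (H : Set G)).index, h1⟩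
    rw [← hmul, mul_comm, pow_mul]
    exact h2

theorem pow_relIndex_mem_of_isNilpotent {G : Type*} [Group G] [Group.IsNilpotent G]
    {H K : Subgroup G} (hHK : H.relIndex K ≠ 0) {g : G} (hg : g ∈ K) : g ^ H.relIndex K ∈ H :=
  pow_index_mem_of_isNilpotent (H.subgroupOf K) hHK ⟨g, hg⟩

/-- A subgroup `K` of `L` that meets every left coset of `H ∩ L` in `L` has the same index relative
to `H` as `L`. -/
theorem relIndex_eq_of_forall_exists {G : Type*} [Group G] {H K L : Subgroup G} (hKL : K ≤ L)
    (h : ∀ x ∈ L, ∃ y ∈ K, y⁻¹ * x ∈ H) : H.relIndex K = H.relIndex L := by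
  refine Nat.card_congr (Equiv.ofBijective (quotientSubgroupOfEmbeddingOfLE H hKL)
    ⟨(quotientSubgroupOfEmbeddingOfLE H hKL).injective, fun x => ?_⟩)
  induction x using QuotientGroup.induction_on with
  | H x =>
    obtain ⟨y, hy, hyx⟩ := h x x.2
    exact ⟨QuotientGroup.mk ⟨y, hy⟩, QuotientGroup.eq.mpr hyx⟩

section Dense

variable {G T : Type*} [Group G] [Group T] [TopologicalSpace T] [IsTopologicalGroup T]
  {ι : G →* T} {X : Subgroup G}

/-- Intersecting open subgroups with a dense subgroup preserves indices. -/
theorem relIndex_comap_inf_of_dense (hX : Dense (X.map ι : Set T)) {H K : Subgroup T}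
    (hH : IsOpen (H : Set T)) (hK : IsOpen (K : Set T)) :
    (H.comap ι ⊓ X).relIndex (K.comap ι ⊓ X) = H.relIndex K := by
  have h1 : (H.comap ι ⊓ X).relIndex (K.comap ι ⊓ X) =
      (H.comap ι).relIndex (K.comap ι ⊓ X) := by
    rw [← inf_relIndex_right, inf_assoc, inf_eq_right.mpr (inf_le_right : K.comap ι ⊓ X ≤ X),
      inf_relIndex_right]
  rw [h1, relIndex_comap]
  refine relIndex_eq_of_forall_exists ?_ fun x hx => ?_
  · rintro _ ⟨y, hy, rfl⟩
    exact hy.1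
  · have hopen : IsOpen ((K : Set T) ∩ {y | y⁻¹ * x ∈ H}) :=
      hK.inter (hH.preimage (continuous_inv.mul continuous_const))
    obtain ⟨y, hy, z, hz, rfl⟩ := hX.inter_open_nonempty _ hopen
      ⟨x, hx, by simp [one_mem]⟩
    exact ⟨ι z, ⟨z, ⟨hy.1, hz⟩, rfl⟩, hy.2⟩

theorem comIndex_comap_inf_of_dense (hX : Dense (X.map ι : Set T)) {H K : Subgroup T}
    (hH : IsOpen (H : Set T)) (hK : IsOpen (K : Set T)) :
    comIndex (H.comap ι ⊓ X) (K.comap ι ⊓ X) = comIndex H K := by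
  rw [comIndex, comIndex, relIndex_comap_inf_of_dense hX hH hK,
    relIndex_comap_inf_of_dense hX hK hH]

theorem topologicalClosure_map_comap_inf (hX : Dense (X.map ι : Set T)) {H : Subgroup T}
    (hH : IsOpen (H : Set T)) : ((H.comap ι ⊓ X).map ι).topologicalClosure = H := by
  refine le_antisymm (topologicalClosure_minimal _ ?_ (isClosed_of_isOpen H hH)) fun x hx => ?_
  · rintro _ ⟨y, hy, rfl⟩
    exact hy.1
  · refine _root_.closure_mono ?_ (hX.open_subset_closure_inter hH hx)
    rintro _ ⟨hy, z, hz, rfl⟩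
    exact ⟨z, ⟨hy, hz⟩, rfl⟩

/-- A subgroup of `X` that is open for the topology induced by `ι` has an open closure, and is
recovered from it. -/
theorem isOpen_topologicalClosure_and_comap_inf_eq (hX : Dense (X.map ι : Set T)) {Δ : Subgroup G}
    (hΔ : Δ ≤ X) {V : Set T} (hV : IsOpen V) (h1 : 1 ∈ V) (hVΔ : ∀ x ∈ X, ι x ∈ V → x ∈ Δ) :
    IsOpen ((Δ.map ι).topologicalClosure : Set T) ∧
      (Δ.map ι).topologicalClosure.comap ι ⊓ X = Δ := by
  constructor
  · refine isOpen_of_mem_nhds _ (g := 1) (Filter.mem_of_superset (hV.mem_nhds h1) fun x hx => ?_)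
    refine _root_.closure_mono ?_ (hX.open_subset_closure_inter hV hx)
    rintro _ ⟨hy, z, hz, rfl⟩
    exact ⟨z, hVΔ z hz hy, rfl⟩
  · refine le_antisymm ?_ fun x hx => ⟨le_topologicalClosure _ ⟨x, hx, rfl⟩, hΔ hx⟩
    rintro x ⟨hx, hxX⟩
    have hopen : IsOpen {y | (ι x)⁻¹ * y ∈ V} :=
      hV.preimage (continuous_const.mul continuous_id)
    obtain ⟨_, hy, δ, hδ, rfl⟩ := mem_closure_iff.mp hx _ hopen
      (by simpa using h1)
    have h2 : x⁻¹ * δ ∈ Δ := hVΔ _ (mul_mem (inv_mem hxX) (hΔ hδ)) (by simpa using hy)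
    simpa using mul_mem hδ (inv_mem h2)

/-- A closed subgroup commensurable with an open subgroup is open. -/
theorem isOpen_of_isClosed_of_comIndex_ne_zero {H U : Subgroup T} (hU : IsOpen (U : Set T))
    (hH : IsClosed (H : Set T)) (h : comIndex H U ≠ 0) : IsOpen (H : Set T) := by
  have : (H.subgroupOf U).FiniteIndex := ⟨right_ne_zero_of_mul h⟩
  have h1 : IsOpen (H.subgroupOf U : Set U) := isOpen_of_isClosed_of_finiteIndex _
    (hH.preimage continuous_subtype_val)
  have h2 := hU.isOpenMap_subtype_val _ h1
  refine isOpen_of_mem_nhds _ (g := 1) (Filter.mem_of_superset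
    (h2.mem_nhds ⟨1, one_mem _, rfl⟩) ?_)
  rintro _ ⟨x, hx, rfl⟩
  exact hx

end Dense

end Subgroup

/-! ### Integral points -/

theorem Rat.exists_int_of_forall_norm_le_one {r : ℚ}
    (h : ∀ (q : ℕ) [Fact q.Prime], ‖(r : ℚ_[q])‖ ≤ 1) : ∃ z : ℤ, (z : ℚ) = r := by
  by_contra hr
  have hden : r.den ≠ 1 := fun h1 => hr ⟨r.num, Rat.coe_int_num_of_den_eq_one h1⟩
  obtain ⟨q, hq, hqd⟩ := Nat.exists_prime_and_dvd hden
  have : Fact q.Prime := ⟨hq⟩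
  have hnum : ‖(r.num : ℚ_[q])‖ = 1 := by
    refine le_antisymm (Padic.norm_int_le_one _) (not_lt.mp fun hlt => ?_)
    have h1 : q ∣ r.num.natAbs := Int.natCast_dvd.mp (Padic.norm_intCast_lt_one_iff.mp hlt)
    exact hq.one_lt.ne' (Nat.dvd_one.mp (r.reduced ▸ Nat.dvd_gcd h1 hqd))
  have hd : ‖(r.den : ℚ_[q])‖ < 1 := Padic.norm_natCast_lt_one_iff.mpr hqd
  have h2 : (r : ℚ_[q]) * (r.den : ℚ_[q]) = (r.num : ℚ_[q]) := by
    exact_mod_cast congrArg (fun x : ℚ => (x : ℚ_[q])) (Rat.mul_den_eq_num r)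
  have h3 : ‖(r : ℚ_[q])‖ * ‖(r.den : ℚ_[q])‖ = 1 := by rw [← norm_mul, h2, hnum]
  have h4 := mul_le_mul_of_nonneg_right (h q) (norm_nonneg (r.den : ℚ_[q]))
  linarith

/-- A rational polynomial with an integral constant term takes integral values at all multiples of
a suitable positive integer. -/
theorem Polynomial.exists_forall_dvd_eval_eq_intCast (P : Polynomial ℚ)
    (h0 : ∃ z : ℤ, (z : ℚ) = P.eval 0) :
    ∃ M : ℕ, M ≠ 0 ∧ ∀ N : ℕ, M ∣ N → ∃ z : ℤ, (z : ℚ) = P.eval (N : ℚ) := by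
  obtain ⟨b, hb, Q, hQ⟩ : ∃ b : ℤ, b ≠ 0 ∧ ∃ Q : Polynomial ℤ,
      Q.map (Int.castRingHom ℚ) = Polynomial.C (b : ℚ) * P := by
    obtain ⟨b, hb, h⟩ := IsLocalization.integerNormalization_spec (nonZeroDivisors ℤ) P
    exact ⟨b, nonZeroDivisors.ne_zero hb, _, h.trans (by rw [zsmul_eq_mul]; simp)⟩
  refine ⟨b.natAbs, Int.natAbs_ne_zero.mpr hb, fun N hN => ?_⟩
  obtain ⟨z, hz⟩ := h0
  have hb' : (b : ℚ) ≠ 0 := Int.cast_ne_zero.mpr hb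
  have hev (n : ℤ) : ((Q.eval n : ℤ) : ℚ) = b * P.eval (n : ℚ) := by
    have := congrArg (Polynomial.eval (n : ℚ)) hQ
    rw [Polynomial.eval_mul, Polynomial.eval_C] at this
    rw [← this]
    exact (Polynomial.eval_intCast_map (Int.castRingHom ℚ) Q n).symm
  have hdvd : b ∣ Q.eval (N : ℤ) - Q.eval 0 :=
    (Int.natAbs_dvd_natAbs.mp (by simpa using hN) : b ∣ (N : ℤ)).trans
      (by simpa using Polynomial.sub_dvd_eval_sub (N : ℤ) 0 Q)
  obtain ⟨c, hc⟩ := hdvd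
  refine ⟨z + c, ?_⟩
  have h1 := congrArg (fun x : ℤ => (x : ℚ)) hc
  have h2 := hev N
  have h3 := hev 0
  push_cast at h1 h2 h3 ⊢
  rw [← hz] at h3
  refine mul_left_cancel₀ hb' ?_
  linear_combination h2 - h3 - h1

namespace Points

variable {A : Type*} [CommRing A] [HopfAlgebra ℤ A]

theorem mem_subgroupOver_padicInt_iff {q : ℕ} [Fact q.Prime] {x : Points ℤ A ℚ_[q]} :
    x ∈ subgroupOver ℤ A ℚ_[q] ℤ_[q] ↔ ∀ a, ‖x.hom a‖ ≤ 1 := by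
  rw [subgroupOver, mem_range_map_iff]
  · refine forall_congr' fun a => ⟨?_, fun h => ⟨⟨x.hom a, h⟩, rfl⟩⟩
    rintro ⟨r, hr⟩
    rw [← hr]
    exact r.2
  · exact Subtype.val_injective

theorem mem_subgroupOver_int_iff {x : Points ℤ A ℚ} :
    x ∈ subgroupOver ℤ A ℚ ℤ ↔ ∀ a, ∃ z : ℤ, (z : ℚ) = x.hom a := by
  rw [subgroupOver, mem_range_map_iff]
  · rfl
  · exact Int.cast_injective

theorem isOpen_subgroupOver_padicInt (hA : Algebra.FiniteType ℤ A) (p : ℕ) [Fact p.Prime] :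
    IsOpen (subgroupOver ℤ A ℚ_[p] ℤ_[p] : Set (Points ℤ A ℚ_[p])) := by
  obtain ⟨S, hS⟩ := hA
  have h : (subgroupOver ℤ A ℚ_[p] ℤ_[p] : Set (Points ℤ A ℚ_[p])) =
      ⋂ a ∈ S, {x | x.hom a ∈ Metric.closedBall (0 : ℚ_[p]) 1} := by
    ext x
    simp only [SetLike.mem_coe, mem_subgroupOver_padicInt_iff, Set.mem_iInter,
      mem_closedBall_zero_iff, Set.mem_ofPred_eq]
    refine ⟨fun h a _ => h a, fun h a => ?_⟩
    have ha : a ∈ Algebra.adjoin ℤ (S : Set A) := by rw [hS]; trivial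
    induction ha using Algebra.adjoin_induction with
    | mem a ha => exact h a ha
    | algebraMap z =>
      rw [AlgHom.commutes]
      exact Padic.norm_int_le_one z
    | add a b _ _ ha hb =>
      rw [map_add]
      exact (Padic.nonarchimedean _ _).trans (max_le ha hb)
    | mul a b _ _ ha hb =>
      rw [map_mul, norm_mul]
      exact mul_le_one₀ ha (norm_nonneg _) hb
  rw [h]
  exact isOpen_biInter_finset fun a _ =>
    (IsUltrametricDist.isOpen_closedBall (0 : ℚ_[p]) one_ne_zero).preimage (continuous_hom a)

variable (hG : IsUnipotentAlgebraicGroup ℤ ℚ A)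

/-- Powers of `q`-adically integral points with `q`-adically integral exponents are integral, since
this holds for natural exponents, which are dense. -/
theorem fieldPow_mem_subgroupOver_padicInt {q : ℕ} [Fact q.Prime] {x : Points ℤ A ℚ_[q]}
    (hx : x ∈ subgroupOver ℤ A ℚ_[q] ℤ_[q]) {t : ℚ_[q]} (ht : ‖t‖ ≤ 1) :
    fieldPow hG.unipotent x t ∈ subgroupOver ℤ A ℚ_[q] ℤ_[q] := by
  refine mem_subgroupOver_padicInt_iff.mpr fun a => ?_
  have hcont : Continuous fun s : ℤ_[q] => ‖(fieldPow hG.unipotent x (s : ℚ_[q])).hom a‖ :=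
    (((continuous_hom a).comp (continuous_fieldPow_right hG.unipotent x)).comp
      continuous_subtype_val).norm
  refine PadicInt.denseRange_natCast.induction_on
    (p := fun s : ℤ_[q] => ‖(fieldPow hG.unipotent x (s : ℚ_[q])).hom a‖ ≤ 1) ⟨t, ht⟩
    (isClosed_le hcont continuous_const) fun N => ?_
  rw [PadicInt.coe_natCast, fieldPow_natCast]
  exact mem_subgroupOver_padicInt_iff.mp (pow_mem hx N) a

/-- The inclusion of `G(ℚ)` into `G(ℚ_q)`. -/
abbrev toPadic (A : Type*) [CommRing A] [HopfAlgebra ℤ A] (q : ℕ) [Fact q.Prime] :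
    Points ℤ A ℚ →* Points ℤ A ℚ_[q] :=
  map (IsScalarTower.toAlgHom ℤ ℚ ℚ_[q])

theorem toPadic_hom {q : ℕ} [Fact q.Prime] (x : Points ℤ A ℚ) (a : A) :
    (toPadic A q x).hom a = ((x.hom a : ℚ) : ℚ_[q]) :=
  eq_ratCast (algebraMap ℚ ℚ_[q]) _

theorem toPadic_fieldPow {q : ℕ} [Fact q.Prime] (x : Points ℤ A ℚ) (t : ℚ) :
    toPadic A q (fieldPow hG.unipotent x t) =
      fieldPow hG.unipotent (toPadic A q x) (t : ℚ_[q]) := by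
  rw [toPadic, map_fieldPow]
  rfl

/-- The rational points that are integral at all primes `q ≠ p`, that is, `G(ℤ[1/p])`. -/
def integralAwayFrom (A : Type*) [CommRing A] [HopfAlgebra ℤ A] (p : ℕ) :
    Subgroup (Points ℤ A ℚ) :=
  ⨅ (q : ℕ) (_ : Fact q.Prime) (_ : q ≠ p),
    (subgroupOver ℤ A ℚ_[q] ℤ_[q]).comap (toPadic A q)

theorem mem_integralAwayFrom_iff {p : ℕ} {x : Points ℤ A ℚ} :
    x ∈ integralAwayFrom A p ↔ ∀ (q : ℕ) [Fact q.Prime], q ≠ p →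
      toPadic A q x ∈ subgroupOver ℤ A ℚ_[q] ℤ_[q] := by
  simp only [integralAwayFrom, Subgroup.mem_iInf, Subgroup.mem_comap]

theorem subgroupOver_int_eq (p : ℕ) [Fact p.Prime] : subgroupOver ℤ A ℚ ℤ =
    (subgroupOver ℤ A ℚ_[p] ℤ_[p]).comap (toPadic A p) ⊓ integralAwayFrom A p := by
  ext x
  rw [Subgroup.mem_inf, mem_integralAwayFrom_iff, mem_subgroupOver_int_iff]
  constructor
  · intro h
    have h1 (q : ℕ) [Fact q.Prime] : toPadic A q x ∈ subgroupOver ℤ A ℚ_[q] ℤ_[q] := by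
      refine mem_subgroupOver_padicInt_iff.mpr fun a => ?_
      obtain ⟨z, hz⟩ := h a
      rw [toPadic_hom, ← hz, Rat.cast_intCast]
      exact Padic.norm_int_le_one z
    exact ⟨h1 p, fun q _ _ => h1 q⟩
  · rintro ⟨hp, h⟩ a
    refine Rat.exists_int_of_forall_norm_le_one fun q _ => ?_
    rw [← toPadic_hom]
    refine mem_subgroupOver_padicInt_iff.mp ?_ a
    rcases eq_or_ne q p with rfl | hqp
    · exact hp
    · exact h q hqp

theorem norm_natCast_div_pow_le_one {p q : ℕ} [hp : Fact p.Prime] [hq : Fact q.Prime] (hqp : q ≠ p)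
    (N j : ℕ) : ‖(((N : ℚ) / (p : ℚ) ^ j : ℚ) : ℚ_[q])‖ ≤ 1 := by
  have h : ‖(p : ℚ_[q])‖ = 1 := Padic.norm_natCast_eq_one_iff.mpr
    ((Nat.coprime_primes hq.out hp.out).mpr hqp)
  push_cast
  rw [norm_div, norm_pow, h, one_pow, div_one]
  exact_mod_cast Padic.norm_int_le_one (N : ℤ)

theorem fieldPow_mem_integralAwayFrom {p : ℕ} [Fact p.Prime] {x : Points ℤ A ℚ}
    (hx : x ∈ integralAwayFrom A p) (N j : ℕ) :
    fieldPow hG.unipotent x ((N : ℚ) / (p : ℚ) ^ j) ∈ integralAwayFrom A p := by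
  refine mem_integralAwayFrom_iff.mpr fun q _ hqp => ?_
  rw [toPadic_fieldPow hG]
  exact fieldPow_mem_subgroupOver_padicInt hG (mem_integralAwayFrom_iff.mp hx q hqp)
    (norm_natCast_div_pow_le_one hqp N j)

include hG in
theorem mem_integralAwayFrom_of_pow_mem {p : ℕ} [hp : Fact p.Prime] {x : Points ℤ A ℚ} {j : ℕ}
    (hx : x ^ p ^ j ∈ integralAwayFrom A p) : x ∈ integralAwayFrom A p := by
  have h := fieldPow_mem_integralAwayFrom hG hx 1 j
  rw [Nat.cast_one, one_div, ← Nat.cast_pow,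
    fieldPow_pow_inv hG.unipotent x (pow_ne_zero j hp.out.ne_zero)] at h
  exact h

include hG in
/-- Every rational point of a unipotent group has a positive power that is integral. -/
theorem exists_pow_mem_subgroupOver_int (x : Points ℤ A ℚ) :
    ∃ M : ℕ, M ≠ 0 ∧ x ^ M ∈ subgroupOver ℤ A ℚ ℤ := by
  obtain ⟨S, hS⟩ := hG.finiteType
  have h (a : A) := Polynomial.exists_forall_dvd_eval_eq_intCast
    ((oneParameter hG.unipotent x).hom a)
    (exists_algebraMap_eq_eval_zero hG.unipotent x a)
  choose M hM0 hM using h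
  refine ⟨∏ a ∈ S, M a, Finset.prod_ne_zero_iff.mpr fun a _ => hM0 a,
    mem_subgroupOver_int_iff.mpr fun a => ?_⟩
  have ha : a ∈ Algebra.adjoin ℤ (S : Set A) := by rw [hS]; trivial
  induction ha using Algebra.adjoin_induction with
  | mem a ha =>
    rw [← fieldPow_natCast hG.unipotent, fieldPow_hom]
    exact hM a _ (Finset.dvd_prod_of_mem M ha)
  | algebraMap z => exact ⟨z, by rw [AlgHom.commutes]; rfl⟩
  | add a b _ _ ha hb =>
    obtain ⟨y, hy⟩ := ha
    obtain ⟨z, hz⟩ := hb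
    exact ⟨y + z, by rw [map_add, ← hy, ← hz, Int.cast_add]⟩
  | mul a b _ _ ha hb =>
    obtain ⟨y, hy⟩ := ha
    obtain ⟨z, hz⟩ := hb
    exact ⟨y * z, by rw [map_mul, ← hy, ← hz, Int.cast_mul]⟩

include hG in
/-- Strong approximation: `G(ℤ[1/p])` is dense in `G(ℚ_p)`. Its closure is stable under powers with
exponents in `ℚ_p`, hence contains `G(ℚ)`, which is dense by weak approximation. -/
theorem dense_integralAwayFrom (p : ℕ) [hp : Fact p.Prime] :
    Dense ((integralAwayFrom A p).map (toPadic A p) : Set (Points ℤ A ℚ_[p])) := by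
  have hpow {y : Points ℤ A ℚ} (hy : y ∈ integralAwayFrom A p) (t : ℚ_[p]) :
      fieldPow hG.unipotent (toPadic A p y) t ∈
        closure ((integralAwayFrom A p).map (toPadic A p) : Set (Points ℤ A ℚ_[p])) := by
    have hp0 : (p : ℚ_[p]) ≠ 0 := Nat.cast_ne_zero.mpr hp.out.ne_zero
    -- Write `t = s / p ^ j` with `s` integral, and approximate `s` by natural numbers.
    obtain ⟨j, hj⟩ : ∃ j : ℕ, ‖t * (p : ℚ_[p]) ^ j‖ ≤ 1 := by
      have h1 : Filter.Tendsto (fun j : ℕ => ‖t * (p : ℚ_[p]) ^ j‖) Filter.atTop (nhds 0) := by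
        have := (tendsto_pow_atTop_nhds_zero_of_norm_lt_one
          (Padic.norm_p_lt_one (p := p))).const_mul t
        simpa using this.norm
      exact (h1.eventually (ge_mem_nhds one_pos)).exists
    have hcont : Continuous fun s : ℤ_[p] =>
        fieldPow hG.unipotent (toPadic A p y) ((s : ℚ_[p]) / p ^ j) :=
      (continuous_fieldPow_right hG.unipotent _).comp (continuous_subtype_val.div_const _)
    have key := PadicInt.denseRange_natCast.induction_on
      (p := fun s : ℤ_[p] => fieldPow hG.unipotent (toPadic A p y) ((s : ℚ_[p]) / p ^ j) ∈
        closure ((integralAwayFrom A p).map (toPadic A p) : Set (Points ℤ A ℚ_[p])))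
      ⟨t * (p : ℚ_[p]) ^ j, hj⟩ (isClosed_closure.preimage hcont) fun N => subset_closure
        ⟨fieldPow hG.unipotent y ((N : ℚ) / (p : ℚ) ^ j),
          fieldPow_mem_integralAwayFrom hG hy N j, by
            rw [toPadic_fieldPow hG, PadicInt.coe_natCast]; push_cast; rfl⟩
    rwa [mul_div_cancel_right₀ _ (pow_ne_zero j hp0)] at key
  rw [← dense_closure]
  refine (dense_rational_points hG.unipotent hG.finiteType
    (Padic.denseRange_ratCast p)).mono fun x hx => ?_
  obtain ⟨y, rfl⟩ : x ∈ (toPadic A p).range := (mem_range_map_iff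
    (algebraMap ℚ ℚ_[p]).injective).mpr fun a => by
      obtain ⟨q, hq⟩ := hx a
      exact ⟨q, (eq_ratCast (algebraMap ℚ ℚ_[p]) q).trans hq⟩
  obtain ⟨M, hM0, hM⟩ := exists_pow_mem_subgroupOver_int hG y
  rw [subgroupOver_int_eq p] at hM
  have h := hpow hM.2 (M : ℚ_[p])⁻¹
  rwa [map_pow, fieldPow_pow_inv hG.unipotent _ hM0] at h

end Points

/-! ### Arithmetic lattices -/

namespace Points

variable {A : Type*} [CommRing A] [HopfAlgebra ℤ A] (hG : IsUnipotentAlgebraicGroup ℤ ℚ A)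

include hG in
/-- An element of `G(ℝ)` with a rational positive power is itself rational. -/
theorem mem_subgroupOver_rat_of_pow_mem {x : Points ℤ A ℝ} {m : ℕ} (hm : m ≠ 0)
    (hx : x ^ m ∈ subgroupOver ℤ A ℝ ℚ) : x ∈ subgroupOver ℤ A ℝ ℚ := by
  obtain ⟨y, hy⟩ := hx
  refine ⟨fieldPow hG.unipotent y (m : ℚ)⁻¹, ?_⟩
  rw [map_fieldPow, hy]
  have h : IsScalarTower.toAlgHom ℤ ℚ ℝ (m : ℚ)⁻¹ = (m : ℝ)⁻¹ := by
    rw [IsScalarTower.toAlgHom_apply]; simp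
  rw [h, fieldPow_pow_inv hG.unipotent x hm]

theorem map_subgroupOver_int :
    (subgroupOver ℤ A ℚ ℤ).map (map (IsScalarTower.toAlgHom ℤ ℚ ℝ)) = subgroupOver ℤ A ℝ ℤ := by
  rw [subgroupOver, subgroupOver, MonoidHom.map_range]
  rfl

theorem map_rat_real_injective :
    Function.Injective (map (A := A) (IsScalarTower.toAlgHom ℤ ℚ ℝ)) :=
  map_injective (algebraMap ℚ ℝ).injective

include hG in
theorem le_subgroupOver_rat_of_commensurable {Δ : Subgroup (Points ℤ A ℝ)}
    (hΔ : Δ.Commensurable (subgroupOver ℤ A ℝ ℤ)) : Δ ≤ subgroupOver ℤ A ℝ ℚ := by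
  intro x hx
  obtain ⟨m, hm, -, hxm⟩ := Subgroup.exists_pow_mem_of_relIndex_ne_zero hΔ.2 hx
  refine mem_subgroupOver_rat_of_pow_mem hG hm.ne' ?_
  rw [← map_subgroupOver_int] at hxm
  obtain ⟨y, -, hy⟩ := hxm.1
  exact ⟨y, hy⟩

/-- For a subgroup `Δ` of `G(ℚ)` commensurable with `G(ℤ)` with indices powers of `p`, the elements
of `Δ` are integral at all primes other than `p`. -/
theorem le_integralAwayFrom {p : ℕ} [hp : Fact p.Prime] {k : ℕ} {Δ : Subgroup (Points ℤ A ℚ)}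
    (hG : IsUnipotentAlgebraicGroup ℤ ℚ A)
    (hΔ : comIndex Δ (subgroupOver ℤ A ℚ ℤ) = p ^ k) : Δ ≤ integralAwayFrom A p := by
  intro x hx
  have : Group.IsNilpotent (Points ℤ A ℚ) := isNilpotent_of_isUnipotentOver hG.unipotent
  obtain ⟨a, -, ha⟩ := (Nat.dvd_prime_pow hp.out).mp (Dvd.intro _ hΔ)
  have h := Subgroup.pow_relIndex_mem_of_isNilpotent
    (ha.trans_ne (pow_ne_zero a hp.out.ne_zero)) hx
  rw [ha, subgroupOver_int_eq p] at h
  exact mem_integralAwayFrom_of_pow_mem hG h.2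

/-- A subgroup `Δ` of `G(ℚ)` commensurable with `G(ℤ)` with indices powers of `p` is open for the
`p`-adic topology on `G(ℤ[1/p])`: an element of `G(ℤ[1/p])` that is close to `1` has a `p ^ b`-th
root in `G(ℤ)`, and `p ^ b`-th powers of elements of `G(ℤ)` lie in `Δ`. -/
theorem exists_isOpen_forall_mem {p : ℕ} [hp : Fact p.Prime] {k : ℕ}
    {Δ : Subgroup (Points ℤ A ℚ)} (hG : IsUnipotentAlgebraicGroup ℤ ℚ A)
    (hΔ : comIndex Δ (subgroupOver ℤ A ℚ ℤ) = p ^ k) :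
    ∃ V : Set (Points ℤ A ℚ_[p]), IsOpen V ∧ 1 ∈ V ∧
      ∀ x ∈ integralAwayFrom A p, toPadic A p x ∈ V → x ∈ Δ := by
  have : Group.IsNilpotent (Points ℤ A ℚ) := isNilpotent_of_isUnipotentOver hG.unipotent
  obtain ⟨b, -, hb⟩ := (Nat.dvd_prime_pow hp.out).mp (Dvd.intro_left _ hΔ)
  have hpb : p ^ b ≠ 0 := pow_ne_zero b hp.out.ne_zero
  refine ⟨{y | fieldPow hG.unipotent y ((p ^ b : ℕ) : ℚ_[p])⁻¹ ∈ subgroupOver ℤ A ℚ_[p] ℤ_[p]},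
    (isOpen_subgroupOver_padicInt hG.finiteType p).preimage
      (continuous_fieldPow_left hG.unipotent _), ?_, fun x hx hxV => ?_⟩
  · have h : fieldPow hG.unipotent (1 : Points ℤ A ℚ_[p]) ((p ^ b : ℕ) : ℚ_[p])⁻¹ = 1 := by
      simpa using fieldPow_pow_inv hG.unipotent (1 : Points ℤ A ℚ_[p]) hpb
    simp only [Set.mem_ofPred_eq, h, one_mem]
  · have hroot : fieldPow hG.unipotent x ((p ^ b : ℕ) : ℚ)⁻¹ ∈ subgroupOver ℤ A ℚ ℤ := by
      rw [subgroupOver_int_eq p]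
      refine Subgroup.mem_inf.mpr ⟨?_, ?_⟩
      · rw [Subgroup.mem_comap, toPadic_fieldPow hG]
        simpa using hxV
      · simpa using fieldPow_mem_integralAwayFrom hG hx 1 b
    have h := Subgroup.pow_relIndex_mem_of_isNilpotent (hb.trans_ne hpb) hroot
    rwa [hb, fieldPow_inv_pow hG.unipotent x hpb] at h

/-- The arithmetic lattices of index `n` are the images of the subgroups of `G(ℚ)` with
commensurability index `n` relative to `G(ℤ)`. Here `n ≠ 0`, because `comIndex` is `0` for subgroups
that are not commensurable. -/
theorem mem_arithmeticLatticesOfIndex_iff (hG : IsUnipotentAlgebraicGroup ℤ ℚ A) {n : ℕ}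
    (hn : n ≠ 0) {Δ : Subgroup (Points ℤ A ℝ)} :
    Δ ∈ arithmeticLatticesOfIndex A n ↔ ∃ Δ' : Subgroup (Points ℤ A ℚ),
      comIndex Δ' (subgroupOver ℤ A ℚ ℤ) = n ∧ Δ'.map (map (IsScalarTower.toAlgHom ℤ ℚ ℝ)) = Δ := by
  have hmap (Δ' : Subgroup (Points ℤ A ℚ)) :
      comIndex (Δ'.map (map (IsScalarTower.toAlgHom ℤ ℚ ℝ))) (subgroupOver ℤ A ℝ ℤ) =
        comIndex Δ' (subgroupOver ℤ A ℚ ℤ) := by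
    rw [← map_subgroupOver_int, comIndex, comIndex,
      Subgroup.relIndex_map_map_of_injective _ _ map_rat_real_injective,
      Subgroup.relIndex_map_map_of_injective _ _ map_rat_real_injective]
  constructor
  · rintro ⟨hΔ, hn'⟩
    have h := Subgroup.map_comap_eq_self (le_subgroupOver_rat_of_commensurable hG hΔ)
    refine ⟨_, ?_, h⟩
    rw [← hmap, h, hn']
  · rintro ⟨Δ', hn', rfl⟩
    rw [← hmap] at hn'
    refine ⟨⟨fun h => hn ?_, fun h => hn ?_⟩, hn'⟩
    · rw [← hn', comIndex, h, mul_zero]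
    · rw [← hn', comIndex, h, zero_mul]

end Points

end

theorem mainTheorem5 {A : Type*} [CommRing A] [HopfAlgebra ℤ A]
    (hA : IsUnipotentAlgebraicGroup ℤ ℚ A) (p : ℕ) [Fact p.Prime] (k : ℕ) :
    (∀ Δ ∈ arithmeticLatticesOfIndex A (p ^ k), Δ ≤ Points.subgroupOver ℤ A ℝ ℚ) ∧
      Set.BijOn (padicClosure A p) (arithmeticLatticesOfIndex A (p ^ k))
        (closedSubgroupsOfIndex A p (p ^ k)) := by
  have hpk : p ^ k ≠ 0 := pow_ne_zero k (Fact.out : p.Prime).ne_zero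
  have hX := Points.dense_integralAwayFrom hA p
  have hUo := Points.isOpen_subgroupOver_padicInt hA.finiteType p
  have hclosure (Δ : Subgroup (Points ℤ A ℚ)) :
      padicClosure A p (Δ.map (Points.map (IsScalarTower.toAlgHom ℤ ℚ ℝ))) =
        (Δ.map (Points.toPadic A p)).topologicalClosure := by
    rw [padicClosure, Subgroup.comap_map_eq_self_of_injective Points.map_rat_real_injective]
  have hopen {Δ : Subgroup (Points ℤ A ℚ)}
      (hΔ : comIndex Δ (Points.subgroupOver ℤ A ℚ ℤ) = p ^ k) :
      IsOpen ((Δ.map (Points.toPadic A p)).topologicalClosure : Set (Points ℤ A ℚ_[p])) ∧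
        (Δ.map (Points.toPadic A p)).topologicalClosure.comap (Points.toPadic A p) ⊓
          Points.integralAwayFrom A p = Δ := by
    obtain ⟨V, hV, h1, hVΔ⟩ := Points.exists_isOpen_forall_mem hA hΔ
    exact Subgroup.isOpen_topologicalClosure_and_comap_inf_eq hX
      (Points.le_integralAwayFrom hA hΔ) hV h1 hVΔ
  refine ⟨fun Δ hΔ => Points.le_subgroupOver_rat_of_commensurable hA hΔ.1, ?_, ?_, ?_⟩
  · intro Δ hΔ
    obtain ⟨Δ, h₁, rfl⟩ := (Points.mem_arithmeticLatticesOfIndex_iff hA hpk).mp hΔ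
    rw [hclosure]
    refine ⟨Subgroup.isClosed_topologicalClosure _, ?_⟩
    rw [← Subgroup.comIndex_comap_inf_of_dense hX (hopen h₁).1 hUo, (hopen h₁).2,
      ← Points.subgroupOver_int_eq, h₁]
  · intro Δ hΔ Δ' hΔ' h
    obtain ⟨Δ, h₁, rfl⟩ := (Points.mem_arithmeticLatticesOfIndex_iff hA hpk).mp hΔ
    obtain ⟨Δ', h₂, rfl⟩ := (Points.mem_arithmeticLatticesOfIndex_iff hA hpk).mp hΔ'
    rw [hclosure, hclosure] at h
    rw [← (hopen h₁).2, h, (hopen h₂).2]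
  · rintro H ⟨hH, hHk⟩
    have hHo := Subgroup.isOpen_of_isClosed_of_comIndex_ne_zero hUo hH (hHk.trans_ne hpk)
    refine ⟨(H.comap (Points.toPadic A p) ⊓ Points.integralAwayFrom A p).map
      (Points.map (IsScalarTower.toAlgHom ℤ ℚ ℝ)),
      (Points.mem_arithmeticLatticesOfIndex_iff hA hpk).mpr ⟨_, ?_, rfl⟩, ?_⟩
    · rw [Points.subgroupOver_int_eq p, Subgroup.comIndex_comap_inf_of_dense hX hHo hUo, hHk]
    · rw [hclosure, Subgroup.topologicalClosure_map_comap_inf hX hHo]
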